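/- Let $d\ge 1$ and $\sigma\in(0,1)$. There is a constant $c_{d,\sigma}\in(-\infty,0)$ such that for all $\xi\in\mathbb R^d$ $$|\xi|^\sigma=c_{d,\sigma}\int_{\mathbb R^d}\frac{e^{i h\cdot\xi}-1}{|h|^{d+\sigma}}\,dh ,$$ the integral being absolutely convergent, and such that the following holds. Notation. For $s\in\mathbb R$, $p\in(1,\infty)$ and a complex Banach space $X$, let $\mathcal S'(\mathbb R^d;X)$ be the space of continuous linear maps $\mathcal S(\mathbb R^d)\to X$, and let $H^{s,p}(\mathbb R^d;X)$ be the space of all $f\in\mathcal S'(\mathbb R^d;X)$ with $(1-\Delta)^{s/2}f:=\mathscr F^{-1}[(1+|\cdot|^2)^{s/2}\widehat f\,]\in L^p(\mathbb R^d;X)$, normed by $\|f\|_{H^{s,p}}=\|(1-\Delta)^{s/2}f\|_{L^p}$, where the Fourier transform is taken with kernel $e^{-ix\cdot\xi}$; write $H^{s,p}(\mathbb R^d)$ for $X=\mathbb C$. On the scalar space $H^{s,p}(\mathbb R^d)$ let $(-\Delta)^{\sigma/2}$ be the bounded linear operator $H^{s,p}(\mathbb R^d)\to H^{s-\sigma,p}(\mathbb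 R^d)$ with $(-\Delta)^{\sigma/2}\varphi=\mathscr F^{-1}[\,|\cdot|^\sigma\widehat\varphi\,]$ for all $\varphi\in\mathcal S(\mathbb R^d)$ (this operator exists and is unique), and on the algebraic tensor product $H^{s,p}(\mathbb R^d)\otimes X\subseteq H^{s,p}(\mathbb R^d;X)$ put $(-\Delta)^{\sigma/2}(g\otimes x)=((-\Delta)^{\sigma/2}g)\otimes x$, extended linearly. For $0<r<R$ let $A(r,R)=\{h\in\mathbb R^d: r<|h|<R\}$. Claim. Let $p\in(1,\infty)$, $s\ge 0$, let $X$ be any complex Banach space (the UMD property is not assumed), and let $f\in H^{s,p}(\mathbb R^d)\otimes X$. Then $f\in L^p(\mathbb R^d;X)$. For $0<r<R$ the integral $$ I_{r,R}f(x)=\int_{A(r,R)}\frac{f(x+h)-f(x)}{|h|^{d+\sigma}}\,dh$$ converges absolutely for almost every $x\in\mathbb R^d$, the function $I_{r,R}f$ belongs to $L^p(\mathbb R^d;X)\cap H^{s-2,p}(\mathbb R^d;X)$, and $(-\Delta)^{\sigma/2}f\in H^{s-2,p}(\mathbb R^d;X)$. Moreover $$(-\Delta)^{\sigma/2}f=c_{d,\sigma}\lim_{r\searrow0,\;R\nearrow\infty}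 I_{r,R}f\qquad\text{in } H^{s-2,p}(\mathbb R^d;X).$$ -/

import Mathlib

open scoped SchwartzMap FourierTransform TensorProduct ENNReal Topology
open MeasureTheory

noncomputable section

/-- The Euclidean space `ℝ^d`. -/
abbrev Rd (d : ℕ) : Type := EuclideanSpace ℝ (Fin d)

/-! ### Bessel potential operators

In Mathlib the Fourier transform has the kernel `exp (-2 π i ⟪x, ξ⟫)`; with respect to it the
operator `m(D)` with symbol `m(ξ)` (for the kernel `exp (-i ⟪x, ξ⟫)`) has the symbol `m(2 π ξ)`. -/

/-- The symbol of `(1 - Δ)^{s/2}`. -/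
def besselSymbol (d : ℕ) (s : ℝ) (ξ : Rd d) : ℂ :=
  (((1 + ‖(2 * Real.pi) • ξ‖ ^ 2) ^ (s / 2) : ℝ) : ℂ)

theorem besselSymbol_real_hasTemperateGrowth (d : ℕ) (s : ℝ) :
    (fun ξ : Rd d ↦ ((1 + ‖(2 * Real.pi) • ξ‖ ^ 2) ^ (s / 2) : ℝ)).HasTemperateGrowth := by
  have h1 := Function.hasTemperateGrowth_one_add_norm_sq_rpow (Rd d) (s / 2)
  have h2 : (fun ξ : Rd d ↦ (2 * Real.pi) • ξ).HasTemperateGrowth := by fun_prop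
  exact h1.comp h2

theorem besselSymbol_hasTemperateGrowth (d : ℕ) (s : ℝ) :
    (besselSymbol d s).HasTemperateGrowth := by
  have h1 := besselSymbol_real_hasTemperateGrowth d s
  unfold besselSymbol
  fun_prop

theorem besselSymbol_mul (d : ℕ) (s t : ℝ) :
    besselSymbol d s * besselSymbol d t = besselSymbol d (s + t) := by
  ext ξ
  have h : (0 : ℝ) < 1 + ‖(2 * Real.pi) • ξ‖ ^ 2 := by positivity
  simp only [Pi.mul_apply, besselSymbol]
  rw [← Complex.ofReal_mul, ← Real.rpow_add h]
  congr 2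
  ring

theorem besselSymbol_zero (d : ℕ) : besselSymbol d 0 = fun _ ↦ 1 := by
  ext ξ
  simp [besselSymbol]

/-- The Bessel potential operator `J_s = (1 - Δ)^{s/2}` on `X`-valued tempered distributions. -/
def besselJ (d : ℕ) (s : ℝ) (X : Type*) [NormedAddCommGroup X] [NormedSpace ℂ X] :
    𝓢'(Rd d, X) →L[ℂ] 𝓢'(Rd d, X) :=
  TemperedDistribution.fourierMultiplierCLM X (besselSymbol d s)

theorem besselJ_neg_besselJ (d : ℕ) (s : ℝ) (X : Type*) [NormedAddCommGroup X] [NormedSpace ℂ X]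
    (f : 𝓢'(Rd d, X)) : besselJ d (-s) X (besselJ d s X f) = f := by
  unfold besselJ
  rw [TemperedDistribution.fourierMultiplierCLM_fourierMultiplierCLM_apply
    (besselSymbol_hasTemperateGrowth d s) (besselSymbol_hasTemperateGrowth d (-s)),
    besselSymbol_mul, add_neg_cancel, besselSymbol_zero,
    TemperedDistribution.fourierMultiplierCLM_const]
  simp

section Bessel

variable (d : ℕ) (s : ℝ) (p : ℝ≥0∞) [Fact (1 ≤ p)]
  (X : Type*) [NormedAddCommGroup X] [NormedSpace ℂ X] [CompleteSpace X]

/-- The Lebesgue space `L^p(ℝ^d; X)` as a subspace of the tempered distributions. -/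
def lpDistributions : Submodule ℂ 𝓢'(Rd d, X) :=
  LinearMap.range (Lp.toTemperedDistributionCLM X (volume : Measure (Rd d)) p).toLinearMap

/-- The Bessel potential space `H^{s,p}(ℝ^d; X)` as a subspace of the tempered distributions:
all `f` with `J_s f ∈ L^p(ℝ^d; X)`. -/
def besselSubmodule : Submodule ℂ 𝓢'(Rd d, X) :=
  (lpDistributions d p X).comap (besselJ d s X).toLinearMap

/-- The Bessel potential space `H^{s,p}(ℝ^d; X)`; it carries the norm `‖J_s f‖_{L^p}`
(see `BesselSpace.norm_eq`), not the topology of the tempered distributions. -/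
def BesselSpace : Type _ := ↥(besselSubmodule d s p X)

namespace BesselSpace

instance : AddCommGroup (BesselSpace d s p X) :=
  inferInstanceAs (AddCommGroup ↥(besselSubmodule d s p X))

instance : Module ℂ (BesselSpace d s p X) :=
  inferInstanceAs (Module ℂ ↥(besselSubmodule d s p X))

/-- The inclusion `H^{s,p}(ℝ^d; X) ⊆ 𝓢'(ℝ^d; X)`. -/
def toDist : BesselSpace d s p X →ₗ[ℂ] 𝓢'(Rd d, X) := (besselSubmodule d s p X).subtype

theorem toDist_injective : Function.Injective (toDist d s p X) :=
  Subtype.val_injective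

/-- `L^p(ℝ^d; X)` is linearly isomorphic to its image in the tempered distributions. -/
def lpEquiv : Lp X p (volume : Measure (Rd d)) ≃ₗ[ℂ] lpDistributions d p X :=
  LinearEquiv.ofInjective
    (Lp.toTemperedDistributionCLM X (volume : Measure (Rd d)) p).toLinearMap
    (LinearMap.ker_eq_bot.mp (Lp.ker_toTemperedDistributionCLM_eq_bot))

/-- `f ↦ J_s f`, as a map from `H^{s,p}(ℝ^d; X)` to `L^p(ℝ^d; X)`. -/
def toLp : BesselSpace d s p X →ₗ[ℂ] Lp X p (volume : Measure (Rd d)) :=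
  (lpEquiv d p X).symm.toLinearMap ∘ₗ
    ((besselJ d s X).toLinearMap.restrict (p := besselSubmodule d s p X)
      (q := lpDistributions d p X) fun _ hf ↦ hf)

theorem toLp_spec (f : BesselSpace d s p X) :
    (toLp d s p X f : 𝓢'(Rd d, X)) = besselJ d s X (toDist d s p X f) := by
  have h := LinearEquiv.apply_symm_apply (lpEquiv d p X)
    (((besselJ d s X).toLinearMap.restrict (p := besselSubmodule d s p X)
      (q := lpDistributions d p X) fun _ hf ↦ hf) f)
  exact congrArg Subtype.val h

theorem toLp_injective : Function.Injective (toLp d s p X) := by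
  intro f g h
  apply toDist_injective
  rw [← besselJ_neg_besselJ d s X (toDist d s p X f),
    ← besselJ_neg_besselJ d s X (toDist d s p X g), ← toLp_spec, ← toLp_spec, h]

instance : NormedAddCommGroup (BesselSpace d s p X) :=
  NormedAddCommGroup.induced _ _ (toLp d s p X) (toLp_injective d s p X)

instance : NormedSpace ℂ (BesselSpace d s p X) :=
  NormedSpace.induced ℂ _ _ (toLp d s p X)

/-- `‖f‖_{H^{s,p}} = ‖J_s f‖_{L^p}`. -/
theorem norm_eq (f : BesselSpace d s p X) (g : Lp X p (volume : Measure (Rd d)))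
    (h : besselJ d s X (toDist d s p X f) = g) : ‖f‖ = ‖g‖ := by
  have h1 : toLp d s p X f = g := by
    apply LinearMap.ker_eq_bot.mp
      (Lp.ker_toTemperedDistributionCLM_eq_bot (μ := (volume : Measure (Rd d))) (F := X) (p := p))
    exact (toLp_spec d s p X f).trans h
  rw [← h1]
  rfl

end BesselSpace

/-! ### Schwartz functions and tensors in Bessel potential spaces -/

variable {d X} in
theorem schwartz_mem_besselSubmodule (φ : 𝓢(Rd d, X)) :
    SchwartzMap.toTemperedDistributionCLM (Rd d) X volume φ ∈ besselSubmodule d s p X := by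
  refine ⟨(SchwartzMap.fourierMultiplierCLM X (besselSymbol d s) φ).toLp p, ?_⟩
  change ((SchwartzMap.toLp _ p _ : Lp X p (volume : Measure (Rd d))) : 𝓢'(Rd d, X)) =
    besselJ d s X _
  rw [besselJ, Lp.toTemperedDistribution_toLp_eq,
    TemperedDistribution.fourierMultiplierCLM_toTemperedDistributionCLM_eq
      (besselSymbol_hasTemperateGrowth d s)]

variable {d X} in
/-- A Schwartz function as an element of `H^{s,p}(ℝ^d; X)`. -/
def BesselSpace.ofSchwartz (φ : 𝓢(Rd d, X)) : BesselSpace d s p X :=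
  ⟨SchwartzMap.toTemperedDistributionCLM (Rd d) X volume φ, schwartz_mem_besselSubmodule s p φ⟩

/-- The elementary tensor `g ⊗ x ∈ 𝓢'(ℝ^d; X)` of `g ∈ 𝓢'(ℝ^d)` and `x ∈ X`, which maps a test
function `φ` to `g(φ) x`. -/
def distTensor {d : ℕ} {X : Type*} [NormedAddCommGroup X] [NormedSpace ℂ X] (g : 𝓢'(Rd d, ℂ))
    (x : X) : 𝓢'(Rd d, X) :=
  PointwiseConvergenceCLM.postcomp 𝓢(Rd d, ℂ) (ContinuousLinearMap.toSpanSingleton ℂ x) g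

theorem distTensor_apply {d : ℕ} {X : Type*} [NormedAddCommGroup X] [NormedSpace ℂ X]
    (g : 𝓢'(Rd d, ℂ)) (x : X) (φ : 𝓢(Rd d, ℂ)) : distTensor g x φ = g φ • x := by
  rfl

theorem besselJ_distTensor {d : ℕ} (s : ℝ) {X : Type*} [NormedAddCommGroup X] [NormedSpace ℂ X]
    (g : 𝓢'(Rd d, ℂ)) (x : X) :
    besselJ d s X (distTensor g x) = distTensor (besselJ d s ℂ g) x := by
  rfl

variable {d X} in
theorem distTensor_mem {g : 𝓢'(Rd d, ℂ)} (hg : g ∈ besselSubmodule d s p ℂ) (x : X) :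
    distTensor g x ∈ besselSubmodule d s p X := by
  obtain ⟨g', hg'⟩ := hg
  have hg'' : (g' : 𝓢'(Rd d, ℂ)) = besselJ d s ℂ g := hg'
  refine ⟨(ContinuousLinearMap.toSpanSingleton ℂ x).compLp g', ?_⟩
  change ((ContinuousLinearMap.toSpanSingleton ℂ x).compLp g' : 𝓢'(Rd d, X)) =
    besselJ d s X (distTensor g x)
  rw [besselJ_distTensor, ← hg'']
  ext φ
  rw [distTensor_apply, Lp.toTemperedDistribution_apply, Lp.toTemperedDistribution_apply,
    ← integral_smul_const]
  apply integral_congr_ae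
  filter_upwards [(ContinuousLinearMap.toSpanSingleton ℂ x).coeFn_compLp g'] with y hy
  rw [hy, ContinuousLinearMap.toSpanSingleton_apply, smul_assoc]

/-- The canonical map `H^{s,p}(ℝ^d) ⊗ X → H^{s,p}(ℝ^d; X)`, `g ⊗ x ↦ (y ↦ g(y) x)`. -/
def BesselSpace.ofTensor : BesselSpace d s p ℂ ⊗[ℂ] X →ₗ[ℂ] BesselSpace d s p X :=
  TensorProduct.lift <| LinearMap.mk₂ ℂ
    (fun (g : BesselSpace d s p ℂ) (x : X) ↦
      (⟨distTensor g.1 x, distTensor_mem s p g.2 x⟩ : BesselSpace d s p X))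
    (fun g₁ g₂ x ↦ Subtype.ext (by ext φ; exact add_smul (g₁.1 φ) (g₂.1 φ) x))
    (fun c g x ↦ Subtype.ext (by ext φ; exact smul_assoc c (g.1 φ) x))
    (fun g x₁ x₂ ↦ Subtype.ext (by ext φ; exact smul_add (g.1 φ) x₁ x₂))
    (fun c g x ↦ Subtype.ext (by ext φ; exact smul_comm (g.1 φ) c x))

theorem BesselSpace.toDist_ofTensor_tmul (g : BesselSpace d s p ℂ) (x : X) :
    toDist d s p X (ofTensor d s p X (g ⊗ₜ x)) = distTensor (toDist d s p ℂ g) x := by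
  rfl

end Bessel

/-! ### The fractional Laplacian -/

theorem memLp_norm_rpow_smul_schwartz {d : ℕ} {σ : ℝ} (hσ : 0 ≤ σ) (φ : 𝓢(Rd d, ℂ)) :
    MemLp (fun ξ : Rd d ↦ ‖(2 * Real.pi) • ξ‖ ^ σ • φ ξ) 1 volume := by
  rw [memLp_one_iff_integrable]
  obtain ⟨n, hn⟩ := exists_nat_ge σ
  have h1 : Continuous fun ξ : Rd d ↦ ‖(2 * Real.pi) • ξ‖ ^ σ :=
    (continuous_const_smul (2 * Real.pi)).norm.rpow_const fun _ ↦ Or.inr hσ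
  have h2 := (φ.integrable (μ := (volume : Measure (Rd d)))).norm.add
    ((φ.integrable_pow_mul (volume : Measure (Rd d)) n).const_mul ((2 * Real.pi) ^ n))
  refine h2.mono' (h1.smul φ.continuous).aestronglyMeasurable (Filter.Eventually.of_forall ?_)
  intro ξ
  have h3 : ‖(2 * Real.pi) • ξ‖ ^ σ ≤ 1 + ‖(2 * Real.pi) • ξ‖ ^ n := by
    rcases le_total ‖(2 * Real.pi) • ξ‖ 1 with h | h
    · have := Real.rpow_le_one (norm_nonneg ((2 * Real.pi) • ξ)) h hσ
      have : 0 ≤ ‖(2 * Real.pi) • ξ‖ ^ n := by positivity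
      linarith
    · have := Real.rpow_le_rpow_of_exponent_le h hn
      rw [Real.rpow_natCast] at this
      linarith
  have h4 : ‖(2 * Real.pi) • ξ‖ ^ n = (2 * Real.pi) ^ n * ‖ξ‖ ^ n := by
    rw [norm_smul, Real.norm_of_nonneg (by positivity), mul_pow]
  have h5 : 0 ≤ ‖(2 * Real.pi) • ξ‖ ^ σ := by positivity
  simp only [Pi.add_apply]
  rw [norm_smul, Real.norm_of_nonneg h5]
  calc _ ≤ (1 + ‖(2 * Real.pi) • ξ‖ ^ n) * ‖φ ξ‖ := by gcongr
    _ = _ := by rw [h4]; ring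

/-- `(-Δ)^{σ/2} φ` for a Schwartz function `φ`: the inverse Fourier transform of the integrable
function `|2 π ξ|^σ φ^(ξ)`, as a tempered distribution. -/
def fracLaplacianSchwartz {d : ℕ} {σ : ℝ} (hσ : 0 ≤ σ) (φ : 𝓢(Rd d, ℂ)) : 𝓢'(Rd d, ℂ) :=
  𝓕⁻ (((memLp_norm_rpow_smul_schwartz hσ (𝓕 φ)).toLp _ : Lp ℂ 1 (volume : Measure (Rd d))) :
    𝓢'(Rd d, ℂ))

/-- `A` is the operator `(-Δ)^{σ/2}` from `H^{s,p}(ℝ^d)` to `H^{s-σ,p}(ℝ^d)`: a bounded linear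
operator that extends the one given on Schwartz functions by the symbol. -/
def IsFracLaplacian {d : ℕ} {σ : ℝ} (hσ : 0 ≤ σ) (s : ℝ) (p : ℝ≥0∞) [Fact (1 ≤ p)]
    (A : BesselSpace d s p ℂ →L[ℂ] BesselSpace d (s - σ) p ℂ) : Prop :=
  ∀ φ : 𝓢(Rd d, ℂ), BesselSpace.toDist d (s - σ) p ℂ (A (BesselSpace.ofSchwartz s p φ)) =
    fracLaplacianSchwartz hσ φ

/-! ### Truncated singular integrals -/

/-- The open annulus `A(r, R)` in `ℝ^d`. -/
def annulus (d : ℕ) (r R : ℝ) : Set (Rd d) := {h | r < ‖h‖ ∧ ‖h‖ < R}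

/-- The difference quotient `(f(x + h) - f(x)) / |h|^{d+σ}`. -/
def diffQuot {d : ℕ} {X : Type*} [NormedAddCommGroup X] [NormedSpace ℂ X] (σ : ℝ) (f : Rd d → X)
    (x h : Rd d) : X :=
  (‖h‖ ^ ((d : ℝ) + σ))⁻¹ • (f (x + h) - f x)

/-- The truncated singular integral `x ↦ ∫_{A(r,R)} (f(x + h) - f(x)) / |h|^{d+σ} dh`. -/
def truncInt {d : ℕ} {X : Type*} [NormedAddCommGroup X] [NormedSpace ℂ X] (σ r R : ℝ)
    (f : Rd d → X) (x : Rd d) : X :=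
  ∫ h in annulus d r R, diffQuot σ f x h

/-- The tempered distribution `u` is given by the function `g`, which belongs to `L^p`. -/
def IsGivenBy {d : ℕ} {X : Type*} [NormedAddCommGroup X] [NormedSpace ℂ X] [CompleteSpace X]
    (p : ℝ≥0∞) [Fact (1 ≤ p)] (u : 𝓢'(Rd d, X)) (g : Rd d → X) : Prop :=
  ∃ hg : MemLp g p (volume : Measure (Rd d)),
    u = (hg.toLp g : Lp X p (volume : Measure (Rd d)))

end

/-!
The idea is to smooth the truncated integrals by `(1 - Δ)^{-1}`. Write `τ_h g = g (· + h)` for the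
isometric translations of `L^p(ℝ^d; X)`. The operator `(1 - Δ)^{-1}` is an average of translations
against a kernel with integrable gradient, so that `‖(τ_h - 1) (1 - Δ)^{-1} g‖ ≤ C min(1, |h|) ‖g‖`
(`exists_bessel_two`). As `|h|^{-d-σ} min(1, |h|)` is integrable, the singular integral
`S g = ∫ |h|^{-d-σ} (τ_h - 1) (1 - Δ)^{-1} g dh` converges absolutely as a Bochner integral in
`L^p(ℝ^d; X)`, and the integrals over annuli converge to it by dominated convergence
(`exists_smoothed_singular_integral`). No property of the Banach space `X` is needed.

Operators are identified through their symbols (`HasSymbol`): for Schwartz functions this is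
Fubini's theorem (`HasSymbol.integral`), and the rest follows by density
(`HasSymbol.eq_fourierMultiplierCLM`). In particular `c S` has the symbol of
`(1 - Δ)^{-1} (-Δ)^{σ/2}`, where `c` is the constant in the formula for `|ξ|^σ`
(`exists_rieszConstant`), obtained from homogeneity and rotation invariance.

The operator `(-Δ)^{σ/2}` from `H^{s,p}` to `H^{s-σ,p}` amounts to the operator on `L^p` with the
symbol `(|ξ|² / (1 + |ξ|²))^{σ/2}`, which is the binomial series of `(1 - (1 - Δ)^{-1})^{σ/2}`; this
series converges absolutely since its coefficients are summable and `(1 - Δ)^{-1}` is a contraction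
(`exists_hasSymbol_fracSymbol`). Finally, the pointwise truncated integrals agree almost everywhere
with the Bochner integrals in `L^p` (`truncInt_ae_eq`), as both have the same integrals against test
functions.
-/

noncomputable section

/-! ### Translations and pairings with Schwartz functions -/

section Translation

variable {d : ℕ} {p : ℝ≥0∞} [Fact (1 ≤ p)] {X : Type*} [NormedAddCommGroup X] [NormedSpace ℂ X]

/-- The translation `g ↦ g (· + h)` on `L^p(ℝ^d; X)`. -/
def translateLp (h : Rd d) :
    Lp X p (volume : Measure (Rd d)) →L[ℂ] Lp X p (volume : Measure (Rd d)) :=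
  (Lp.compMeasurePreservingₗᵢ ℂ (fun x : Rd d ↦ x + h)
    (measurePreserving_add_right volume h)).toContinuousLinearMap

theorem norm_translateLp (h : Rd d) (g : Lp X p (volume : Measure (Rd d))) :
    ‖translateLp h g‖ = ‖g‖ :=
  LinearIsometry.norm_map _ g

theorem coeFn_translateLp (h : Rd d) (g : Lp X p (volume : Measure (Rd d))) :
    translateLp h g =ᵐ[volume] fun x ↦ g (x + h) :=
  Lp.coeFn_compMeasurePreserving g (measurePreserving_add_right volume h)

theorem translateLp_translateLp (h k : Rd d) (g : Lp X p (volume : Measure (Rd d))) :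
    translateLp h (translateLp k g) = translateLp (h + k) g := by
  apply Lp.ext
  have h1 := (measurePreserving_add_right volume h).quasiMeasurePreserving.ae
    (coeFn_translateLp k g)
  filter_upwards [coeFn_translateLp h (translateLp k g), coeFn_translateLp (h + k) g, h1]
    with x hx1 hx2 hx3
  rw [hx1, hx3, hx2, add_assoc]

theorem continuous_translateLp (hp : p ≠ ∞) (g : Lp X p (volume : Measure (Rd d))) :
    Continuous fun h : Rd d ↦ translateLp h g := by
  let F : C(Rd d × Rd d, Rd d) := ⟨fun z ↦ z.2 + z.1, by fun_prop⟩
  exact Continuous.compMeasurePreservingLp (g := fun h : Rd d ↦ F.curry h)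
    (continuous_const (y := g)) F.curry.continuous
    (fun h ↦ measurePreserving_add_right volume h) hp

end Translation

section Pairing

variable {d : ℕ} {p : ℝ≥0∞} [Fact (1 ≤ p)] {X : Type*} [NormedAddCommGroup X] [NormedSpace ℂ X]
  [CompleteSpace X]

/-- The pairing `g ↦ ∫ ψ g` of `L^p(ℝ^d; X)` with a Schwartz function `ψ`. -/
def lpPairing (ψ : 𝓢(Rd d, ℂ)) : Lp X p (volume : Measure (Rd d)) →L[ℂ] X :=
  (PointwiseConvergenceCLM.evalCLM (RingHom.id ℂ) X ψ).comp
    (Lp.toTemperedDistributionCLM X (volume : Measure (Rd d)) p)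

theorem lpPairing_eq_toTemperedDistribution (ψ : 𝓢(Rd d, ℂ))
    (g : Lp X p (volume : Measure (Rd d))) :
    lpPairing ψ g = (g : 𝓢'(Rd d, X)) ψ := rfl

theorem lpPairing_apply (ψ : 𝓢(Rd d, ℂ)) (g : Lp X p (volume : Measure (Rd d))) :
    lpPairing ψ g = ∫ x, ψ x • g x :=
  Lp.toTemperedDistribution_apply g ψ

theorem MeasureTheory.Lp.ext_of_lpPairing {g g' : Lp X p (volume : Measure (Rd d))}
    (h : ∀ ψ : 𝓢(Rd d, ℂ), lpPairing ψ g = lpPairing ψ g') : g = g' := by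
  apply LinearMap.ker_eq_bot.mp
    (Lp.ker_toTemperedDistributionCLM_eq_bot (μ := (volume : Measure (Rd d))) (F := X) (p := p))
  ext ψ
  exact h ψ

theorem lpPairing_translateLp (ψ : 𝓢(Rd d, ℂ)) (h : Rd d)
    (g : Lp X p (volume : Measure (Rd d))) :
    lpPairing ψ (translateLp h g) = lpPairing (ψ.compSubConstCLM ℂ h) g := by
  rw [lpPairing_apply, lpPairing_apply,
    ← integral_add_right_eq_self (fun x ↦ ψ.compSubConstCLM ℂ h x • g x) h]
  apply integral_congr_ae
  filter_upwards [coeFn_translateLp h g] with x hx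
  rw [hx, SchwartzMap.compSubConstCLM_apply, add_sub_cancel_right]

theorem lpPairing_compLp (ψ : 𝓢(Rd d, ℂ)) (g : Lp ℂ p (volume : Measure (Rd d))) (x : X) :
    lpPairing ψ ((ContinuousLinearMap.toSpanSingleton ℂ x).compLp g) = lpPairing ψ g • x := by
  rw [lpPairing_apply, lpPairing_apply, ← integral_smul_const]
  apply integral_congr_ae
  filter_upwards [(ContinuousLinearMap.toSpanSingleton ℂ x).coeFn_compLp g] with y hy
  rw [hy, ContinuousLinearMap.toSpanSingleton_apply, smul_assoc]

/-- The character `ξ ↦ exp (2 π i ⟪h, ξ⟫)`, which is the symbol of the translation by `h`. -/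
def translationSymbol {d : ℕ} (h ξ : Rd d) : ℂ :=
  Complex.exp ((2 * Real.pi * inner ℝ h ξ : ℝ) * Complex.I)

theorem norm_translationSymbol (h ξ : Rd d) : ‖translationSymbol h ξ‖ = 1 :=
  Complex.norm_exp_ofReal_mul_I _

theorem continuous_translationSymbol :
    Continuous fun z : Rd d × Rd d ↦ translationSymbol z.1 z.2 := by
  unfold translationSymbol
  fun_prop

theorem fourierInv_compSubConstCLM (ψ : 𝓢(Rd d, ℂ)) (h ξ : Rd d) :
    𝓕⁻ (ψ.compSubConstCLM ℂ h) ξ = translationSymbol h ξ * 𝓕⁻ ψ ξ := by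
  rw [SchwartzMap.fourierInv_coe, SchwartzMap.fourierInv_coe, Real.fourierInv_eq',
    Real.fourierInv_eq', ← integral_add_right_eq_self _ h, ← integral_const_mul]
  congr 1 with v
  rw [SchwartzMap.compSubConstCLM_apply, add_sub_cancel_right, translationSymbol, smul_eq_mul,
    smul_eq_mul, ← mul_assoc, ← Complex.exp_add, inner_add_left]
  congr 2
  push_cast
  ring

end Pairing

/-! ### Operators given by a bounded symbol -/

section Integrable

variable {d : ℕ} {X : Type*} [NormedAddCommGroup X] [NormedSpace ℂ X]

theorem integrable_schwartz_smul_schwartz (f : 𝓢(Rd d, ℂ)) (g : 𝓢(Rd d, X)) :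
    Integrable fun ξ ↦ f ξ • g ξ := by
  obtain ⟨C, hC⟩ : ∃ C, ∀ x, ‖f x‖ ≤ C :=
    ⟨_, fun x ↦ SchwartzMap.norm_le_seminorm ℂ f x⟩
  refine (g.integrable (μ := (volume : Measure (Rd d)))).norm.const_mul C |>.mono'
    (f.continuous.smul g.continuous).aestronglyMeasurable (Filter.Eventually.of_forall fun x ↦ ?_)
  rw [norm_smul]
  gcongr
  exact hC x

theorem integrable_symbol_smul {m : Rd d → ℂ} (hm : AEStronglyMeasurable m volume)
    (hb : ∃ C, ∀ ξ, ‖m ξ‖ ≤ C) (f : 𝓢(Rd d, ℂ)) (g : 𝓢(Rd d, X)) :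
    Integrable fun ξ ↦ m ξ • (f ξ • g ξ) := by
  obtain ⟨C, hC⟩ := hb
  exact (integrable_schwartz_smul_schwartz f g).bdd_smul C hm (Filter.Eventually.of_forall hC)

end Integrable

section HasSymbol

variable {d : ℕ} {p : ℝ≥0∞} [Fact (1 ≤ p)] {X : Type*} [NormedAddCommGroup X] [NormedSpace ℂ X]
  [CompleteSpace X]

/-- The bounded operator `B` on `L^p(ℝ^d; X)` is the Fourier multiplier operator with the bounded
symbol `m`. This is tested by pairing `B φ` with `ψ` for Schwartz functions `φ` and `ψ`, so that
no smoothness of `m` is needed. -/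
structure HasSymbol
    (B : Lp X p (volume : Measure (Rd d)) →L[ℂ] Lp X p (volume : Measure (Rd d)))
    (m : Rd d → ℂ) : Prop where
  aestronglyMeasurable : AEStronglyMeasurable m volume
  bounded : ∃ C, ∀ ξ, ‖m ξ‖ ≤ C
  lpPairing_eq : ∀ (φ : 𝓢(Rd d, X)) (ψ : 𝓢(Rd d, ℂ)),
    lpPairing ψ (B (φ.toLp p)) = ∫ ξ, m ξ • (𝓕⁻ ψ ξ • 𝓕 φ ξ)

namespace HasSymbol

variable {B B' : Lp X p (volume : Measure (Rd d)) →L[ℂ] Lp X p (volume : Measure (Rd d))}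
  {m m' : Rd d → ℂ}

theorem one : HasSymbol (1 : Lp X p (volume : Measure (Rd d)) →L[ℂ] _) fun _ ↦ 1 where
  aestronglyMeasurable := aestronglyMeasurable_const
  bounded := ⟨1, fun _ ↦ by simp⟩
  lpPairing_eq φ ψ := by
    have h1 : 𝓕⁻ (𝓕 φ) = φ := FourierTransform.fourierInv_fourier_eq φ
    simp only [one_smul, one_apply_eq_self]
    rw [SchwartzMap.integral_fourierInv_smul_eq, h1, lpPairing_eq_toTemperedDistribution,
      Lp.toTemperedDistribution_toLp_eq]
    exact SchwartzMap.toTemperedDistributionCLM_apply_apply _ φ ψ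

theorem congr_ae (h : HasSymbol B m) (hm : m =ᵐ[volume] m') (hb : ∃ C, ∀ ξ, ‖m' ξ‖ ≤ C) :
    HasSymbol B m' where
  aestronglyMeasurable := h.aestronglyMeasurable.congr hm
  bounded := hb
  lpPairing_eq φ ψ := by
    rw [h.lpPairing_eq]
    apply integral_congr_ae
    filter_upwards [hm] with ξ hξ
    rw [hξ]

theorem sub (h : HasSymbol B m) (h' : HasSymbol B' m') :
    HasSymbol (B - B') fun ξ ↦ m ξ - m' ξ where
  aestronglyMeasurable := h.aestronglyMeasurable.sub h'.aestronglyMeasurable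
  bounded := by
    obtain ⟨C, hC⟩ := h.bounded
    obtain ⟨C', hC'⟩ := h'.bounded
    exact ⟨C + C', fun ξ ↦ (norm_sub_le _ _).trans (add_le_add (hC ξ) (hC' ξ))⟩
  lpPairing_eq φ ψ := by
    simp only [sub_apply, map_sub, h.lpPairing_eq, h'.lpPairing_eq, sub_smul]
    rw [integral_sub (integrable_symbol_smul h.aestronglyMeasurable h.bounded _ _)
      (integrable_symbol_smul h'.aestronglyMeasurable h'.bounded _ _)]

theorem const_smul (c : ℂ) (h : HasSymbol B m) : HasSymbol (c • B) fun ξ ↦ c * m ξ where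
  aestronglyMeasurable := h.aestronglyMeasurable.const_mul c
  bounded := by
    obtain ⟨C, hC⟩ := h.bounded
    exact ⟨‖c‖ * C, fun ξ ↦ by rw [norm_mul]; gcongr; exact hC ξ⟩
  lpPairing_eq φ ψ := by
    simp only [smul_apply, map_smul, h.lpPairing_eq, mul_smul]
    rw [integral_smul]

theorem translateLp_comp (h : Rd d) (hB : HasSymbol B m) :
    HasSymbol ((translateLp h).comp B) fun ξ ↦ translationSymbol h ξ * m ξ where
  aestronglyMeasurable := (continuous_translationSymbol.comp
    (Continuous.prodMk_right h)).aestronglyMeasurable.mul hB.aestronglyMeasurable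
  bounded := by
    obtain ⟨C, hC⟩ := hB.bounded
    exact ⟨C, fun ξ ↦ by rw [norm_mul, norm_translationSymbol, one_mul]; exact hC ξ⟩
  lpPairing_eq φ ψ := by
    rw [ContinuousLinearMap.comp_apply, lpPairing_translateLp, hB.lpPairing_eq]
    congr 1 with ξ
    rw [fourierInv_compSubConstCLM, mul_smul, mul_smul, smul_comm]

/-- An integral of operators with symbols has the integral of the symbols as its symbol. -/
theorem integral {Ω : Type*} [MeasurableSpace Ω] {μ : Measure Ω} [SFinite μ]
    {T : Lp X p (volume : Measure (Rd d)) →L[ℂ] Lp X p (volume : Measure (Rd d))}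
    {F : Ω → Lp X p (volume : Measure (Rd d)) →L[ℂ] Lp X p (volume : Measure (Rd d))}
    {k : Ω → Rd d → ℂ} {b : Ω → ℝ} (hF : ∀ ω, HasSymbol (F ω) (k ω))
    (hFi : ∀ g, Integrable (fun ω ↦ F ω g) μ) (hT : ∀ g, T g = ∫ ω, F ω g ∂μ)
    (hk : AEStronglyMeasurable (Function.uncurry k) (μ.prod volume))
    (hb : Integrable b μ) (hkb : ∀ ω ξ, ‖k ω ξ‖ ≤ b ω) :
    HasSymbol T fun ξ ↦ ∫ ω, k ω ξ ∂μ where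
  aestronglyMeasurable := hk.prod_swap.integral_prod_right'
  bounded := ⟨∫ ω, b ω ∂μ, fun ξ ↦
    norm_integral_le_of_norm_le hb (Filter.Eventually.of_forall fun ω ↦ hkb ω ξ)⟩
  lpPairing_eq φ ψ := by
    rw [hT, ← ContinuousLinearMap.integral_comp_comm _ (hFi _)]
    simp only [(hF _).lpPairing_eq]
    rw [integral_integral_swap]
    · congr 1 with ξ
      rw [integral_smul_const]
    · have h1 := hb.norm.mul_prod (integrable_schwartz_smul_schwartz (𝓕⁻ ψ) (𝓕 φ)).norm
      refine h1.mono' (hk.smul ?_) (Filter.Eventually.of_forall fun z ↦ ?_)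
      · exact (integrable_schwartz_smul_schwartz (𝓕⁻ ψ) (𝓕 φ)).aestronglyMeasurable.comp_snd
      · change ‖k z.1 z.2 • _‖ ≤ _
        rw [norm_smul]
        gcongr
        exact (hkb z.1 z.2).trans (le_abs_self _)

/-- The symbol of `B` determines `B` through distributions: if the symbol of `B'` is `b` times the
symbol of `B`, then `B' g = b(D) B g` for all `g ∈ L^p(ℝ^d; X)`, by density of the Schwartz
functions. -/
theorem eq_fourierMultiplierCLM (hp : p ≠ ∞) {b : Rd d → ℂ} (hb : b.HasTemperateGrowth)
    (h : HasSymbol B m) (h' : HasSymbol B' fun ξ ↦ b ξ * m ξ)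
    (g : Lp X p (volume : Measure (Rd d))) :
    (B' g : 𝓢'(Rd d, X)) = TemperedDistribution.fourierMultiplierCLM X b (B g : 𝓢'(Rd d, X)) := by
  ext ψ
  rw [TemperedDistribution.fourierMultiplierCLM_apply_apply,
    ← lpPairing_eq_toTemperedDistribution, ← lpPairing_eq_toTemperedDistribution]
  revert g
  apply congrFun
  apply (SchwartzMap.denseRange_toLpCLM (E := Rd d) (F := X) hp).equalizer
    (by fun_prop) (by fun_prop)
  funext φ
  simp only [Function.comp_apply, SchwartzMap.toLpCLM_apply]
  have h1 : 𝓕⁻ (𝓕 (SchwartzMap.smulLeftCLM ℂ b (𝓕⁻ ψ))) = SchwartzMap.smulLeftCLM ℂ b (𝓕⁻ ψ) :=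
    FourierTransform.fourierInv_fourier_eq _
  rw [h'.lpPairing_eq, h.lpPairing_eq, h1]
  congr 1 with ξ
  rw [SchwartzMap.smulLeftCLM_apply_apply hb, smul_assoc, mul_smul, smul_comm]

/-- Operators with a common symbol act on elementary tensors through their scalar versions. -/
theorem compLp_toSpanSingleton (hp : p ≠ ∞)
    {B₁ : Lp ℂ p (volume : Measure (Rd d)) →L[ℂ] Lp ℂ p (volume : Measure (Rd d))}
    (h₁ : HasSymbol B₁ m) (h : HasSymbol B m) (g : Lp ℂ p (volume : Measure (Rd d))) (x : X) :
    B ((ContinuousLinearMap.toSpanSingleton ℂ x).compLp g) =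
      (ContinuousLinearMap.toSpanSingleton ℂ x).compLp (B₁ g) := by
  apply Lp.ext_of_lpPairing
  intro ψ
  rw [lpPairing_compLp]
  change lpPairing ψ (B ((ContinuousLinearMap.toSpanSingleton ℂ x).compLpL p volume g)) = _
  revert g
  apply congrFun
  apply (SchwartzMap.denseRange_toLpCLM (E := Rd d) (F := ℂ) hp).equalizer
    (by fun_prop) (by fun_prop)
  funext φ
  simp only [Function.comp_apply, SchwartzMap.toLpCLM_apply]
  set L := ContinuousLinearMap.toSpanSingleton ℂ x
  have h2 : L.compLpL p volume (φ.toLp p) = (φ.postcompCLM L).toLp p := by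
    apply Lp.ext
    filter_upwards [L.coeFn_compLp (φ.toLp p), φ.coeFn_toLp p, (φ.postcompCLM L).coeFn_toLp p]
      with y h3 h4 h5
    rw [h5]
    exact h3.trans (by rw [h4]; rfl)
  have h3 : ∀ ξ, 𝓕 (φ.postcompCLM L) ξ = 𝓕 φ ξ • x := by
    intro ξ
    rw [SchwartzMap.fourier_coe, SchwartzMap.fourier_coe, Real.fourier_eq', Real.fourier_eq',
      ← integral_smul_const]
    congr 1 with v
    rw [smul_assoc]
    rfl
  rw [h2, h.lpPairing_eq, h₁.lpPairing_eq, ← integral_smul_const]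
  congr 1 with ξ
  rw [h3, smul_assoc, smul_assoc]

end HasSymbol

/-- A dominated strongly measurable family of bounded operators has a strong integral. -/
theorem exists_strong_integral {V : Type*} [NormedAddCommGroup V] [NormedSpace ℂ V]
    [NormedSpace ℝ V] [SMulCommClass ℝ ℂ V] [CompleteSpace V] {Ω : Type*} [MeasurableSpace Ω]
    {μ : Measure Ω} {F : Ω → V →L[ℂ] V}
    {b : Ω → ℝ} (hb : Integrable b μ) (hF : ∀ g, AEStronglyMeasurable (fun ω ↦ F ω g) μ)
    (hFb : ∀ ω g, ‖F ω g‖ ≤ b ω * ‖g‖) :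
    (∀ g, Integrable (fun ω ↦ F ω g) μ) ∧
      ∃ T : V →L[ℂ] V, (∀ g, T g = ∫ ω, F ω g ∂μ) ∧ ∀ g, ‖T g‖ ≤ (∫ ω, b ω ∂μ) * ‖g‖ := by
  have h1 : ∀ g, Integrable (fun ω ↦ F ω g) μ := fun g ↦
    (hb.mul_const ‖g‖).mono' (hF g) (Filter.Eventually.of_forall fun ω ↦ hFb ω g)
  have h2 : ∀ g, ‖∫ ω, F ω g ∂μ‖ ≤ (∫ ω, b ω ∂μ) * ‖g‖ := by
    intro g
    rw [← integral_mul_const]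
    exact norm_integral_le_of_norm_le (hb.mul_const ‖g‖) (Filter.Eventually.of_forall (hFb · g))
  refine ⟨h1, LinearMap.mkContinuous
    { toFun g := ∫ ω, F ω g ∂μ
      map_add' g g' := by simp only [map_add]; exact integral_add (h1 g) (h1 g')
      map_smul' c g := by simp only [map_smul, RingHom.id_apply]; exact integral_smul c _ }
    (∫ ω, b ω ∂μ) h2, fun g ↦ rfl, h2⟩

end HasSymbol

/-! ### Bessel potentials as averages of translations -/

section Gaussian

variable {d : ℕ}

/-- The Gaussian `y ↦ exp (-π |y|²)`, which has integral `1` and is its own Fourier transform. -/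
def gaussian (y : Rd d) : ℝ := Real.exp (-Real.pi * ‖y‖ ^ 2)

theorem continuous_gaussian : Continuous (gaussian (d := d)) := by
  unfold gaussian
  fun_prop

theorem gaussian_pos (y : Rd d) : 0 < gaussian y := Real.exp_pos _

theorem integrable_gaussian : Integrable (gaussian (d := d)) := by
  have h := (GaussianFourier.integrable_cexp_neg_mul_sq_norm_add (V := Rd d)
    (b := (Real.pi : ℂ)) (by simpa using Real.pi_pos) 0 0).norm
  refine h.congr (Filter.Eventually.of_forall fun y ↦ ?_)
  simp only [Complex.norm_exp, gaussian]
  congr 1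
  simp [← Complex.ofReal_pow, ← Complex.ofReal_mul]

theorem integral_gaussian_mul_translationSymbol (ρ : ℝ) (ξ : Rd d) :
    ∫ y, (gaussian y : ℂ) * translationSymbol (ρ • y) ξ = gaussian (ρ • ξ) := by
  have h := fourier_gaussian_innerProductSpace (V := Rd d) (b := (Real.pi : ℂ))
    (by simpa using Real.pi_pos) (-(ρ • ξ))
  have hpi : (Real.pi : ℂ) ≠ 0 := by exact_mod_cast Real.pi_ne_zero
  rw [Real.fourier_eq', div_self hpi, Complex.one_cpow, one_mul] at h
  rw [show ((gaussian (ρ • ξ) : ℝ) : ℂ) =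
    Complex.exp (-Real.pi ^ 2 * ‖-(ρ • ξ)‖ ^ 2 / Real.pi) by
      rw [gaussian, norm_neg]
      push_cast
      congr 1
      field_simp, ← h]
  congr 1 with y
  rw [mul_comm, smul_eq_mul, translationSymbol, gaussian]
  push_cast
  congr 3
  rw [inner_neg_right, inner_smul_left, inner_smul_right]
  push_cast
  simp

theorem integral_gaussian_eq_one : ∫ y : Rd d, gaussian y = 1 := by
  have h := integral_gaussian_mul_translationSymbol (d := d) 0 0
  simp only [translationSymbol, inner_zero_right, mul_zero, Complex.ofReal_zero, zero_mul,
    Complex.exp_zero, mul_one, integral_complex_ofReal, smul_zero] at h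
  have h1 : gaussian (0 : Rd d) = 1 := by simp [gaussian]
  rw [h1] at h
  exact_mod_cast h

theorem integrable_norm_mul_gaussian : Integrable fun y : Rd d ↦ ‖y‖ * gaussian y := by
  have h := (integrable_gaussian (d := d)).comp_smul (R := (2 : ℝ)⁻¹) (by norm_num)
  refine (h.const_mul (Real.exp 1)).mono'
    (continuous_norm.mul continuous_gaussian).aestronglyMeasurable
    (Filter.Eventually.of_forall fun y ↦ ?_)
  have h1 : ‖y‖ ≤ Real.exp ‖y‖ := by linarith [Real.add_one_le_exp ‖y‖]
  have hpi : 3 < Real.pi := Real.pi_gt_three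
  rw [Real.norm_of_nonneg (mul_nonneg (norm_nonneg _) (gaussian_pos y).le), gaussian, gaussian,
    norm_smul]
  calc ‖y‖ * Real.exp (-Real.pi * ‖y‖ ^ 2)
      ≤ Real.exp ‖y‖ * Real.exp (-Real.pi * ‖y‖ ^ 2) := by gcongr
    _ ≤ Real.exp 1 * Real.exp (-Real.pi * (‖(2 : ℝ)⁻¹‖ * ‖y‖) ^ 2) := by
        rw [← Real.exp_add, ← Real.exp_add]
        apply Real.exp_le_exp.mpr
        rw [Real.norm_of_nonneg (by norm_num)]
        nlinarith [sq_nonneg (‖y‖ - 1), sq_nonneg ‖y‖]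

theorem exp_neg_mul_sq_sub_le {a b δ : ℝ} (ha : 0 ≤ a) (hb : 0 ≤ b) (hδ : |a - b| ≤ δ)
    (hδ1 : δ ≤ 1) :
    Real.exp (-Real.pi * a ^ 2) - Real.exp (-Real.pi * b ^ 2) ≤
      Real.pi * δ * ((2 * a + 1) * Real.exp (-Real.pi * a ^ 2)) := by
  have h1 : Real.exp (-Real.pi * b ^ 2) =
      Real.exp (-Real.pi * a ^ 2) * Real.exp (-(Real.pi * (b ^ 2 - a ^ 2))) := by
    rw [← Real.exp_add]
    congr 1
    ring
  have h2 := Real.one_sub_le_exp_neg (Real.pi * (b ^ 2 - a ^ 2))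
  have h3 : b ^ 2 - a ^ 2 ≤ δ * (2 * a + 1) := by
    obtain ⟨h4, h5⟩ := abs_le.mp hδ
    nlinarith
  have h6 : 1 - Real.exp (-(Real.pi * (b ^ 2 - a ^ 2))) ≤ Real.pi * (δ * (2 * a + 1)) := by
    have := mul_le_mul_of_nonneg_left h3 Real.pi_pos.le
    linarith
  have h7 := mul_le_mul_of_nonneg_left h6 (Real.exp_pos (-Real.pi * a ^ 2)).le
  rw [h1]
  linarith

/-- The `L¹` modulus of continuity of the Gaussian is at most linear. -/
theorem exists_integral_abs_gaussian_sub_le :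
    ∃ C, 0 ≤ C ∧ ∀ v : Rd d, ∫ y, |gaussian (y - v) - gaussian y| ≤ C * ‖v‖ := by
  let G : Rd d → ℝ := fun y ↦ (2 * ‖y‖ + 1) * gaussian y
  have hG : Integrable G := by
    refine ((integrable_norm_mul_gaussian.const_mul 2).add integrable_gaussian).congr
      (Filter.Eventually.of_forall fun y ↦ ?_)
    simp only [Pi.add_apply, G]
    ring
  have hG0 : ∀ y, 0 ≤ G y := fun y ↦ mul_nonneg (by positivity) (gaussian_pos y).le
  have hGI : 0 ≤ ∫ y, G y := integral_nonneg hG0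
  have hpi := Real.pi_pos
  refine ⟨2 * Real.pi * (∫ y, G y) + 2, by positivity, fun v ↦ ?_⟩
  have hγ := integrable_gaussian (d := d)
  have hγv := hγ.comp_sub_right v
  rcases le_total ‖v‖ 1 with hv | hv
  · have h1 : ∀ y, |gaussian (y - v) - gaussian y| ≤ Real.pi * ‖v‖ * (G (y - v) + G y) := by
      intro y
      have h2 : |‖y - v‖ - ‖y‖| ≤ ‖v‖ := by simpa using abs_norm_sub_norm_le (y - v) y
      have h3 := exp_neg_mul_sq_sub_le (norm_nonneg (y - v)) (norm_nonneg y) h2 hv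
      have h4 := exp_neg_mul_sq_sub_le (norm_nonneg y) (norm_nonneg (y - v))
        (by rwa [abs_sub_comm]) hv
      have h5 : 0 ≤ Real.pi * ‖v‖ * G (y - v) := mul_nonneg (by positivity) (hG0 _)
      have h6 : 0 ≤ Real.pi * ‖v‖ * G y := mul_nonneg (by positivity) (hG0 _)
      simp only [G, gaussian] at *
      rw [abs_le]
      constructor <;> linarith
    calc _ ≤ ∫ y, Real.pi * ‖v‖ * (G (y - v) + G y) :=
          integral_mono (hγv.sub hγ).abs (((hG.comp_sub_right v).add hG).const_mul _) h1
      _ = 2 * Real.pi * (∫ y, G y) * ‖v‖ := by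
          rw [integral_const_mul, integral_add (hG.comp_sub_right v) hG,
            integral_sub_right_eq_self]
          ring
      _ ≤ _ := by
          gcongr
          linarith
  · calc _ ≤ ∫ y, (gaussian (y - v) + gaussian y) := by
          refine integral_mono (hγv.sub hγ).abs (hγv.add hγ) fun y ↦ ?_
          have h1 := gaussian_pos (y - v)
          have h2 := gaussian_pos y
          exact (abs_sub _ _).trans (by rw [abs_of_pos h1, abs_of_pos h2])
      _ = 2 := by
          rw [integral_add hγv hγ, integral_sub_right_eq_self, integral_gaussian_eq_one]
          norm_num
      _ ≤ _ := by nlinarith [mul_nonneg hpi.le hGI]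

end Gaussian

section Bessel

theorem integrable_heat {d : ℕ} {p : ℝ≥0∞} [Fact (1 ≤ p)] {X : Type*} [NormedAddCommGroup X]
    [NormedSpace ℂ X] (hp : p ≠ ∞) (ρ : ℝ) (g : Lp X p (volume : Measure (Rd d))) :
    Integrable fun y : Rd d ↦ gaussian y • translateLp (ρ • y) g := by
  refine (integrable_gaussian.mul_const ‖g‖).mono' ?_ (Filter.Eventually.of_forall fun y ↦ ?_)
  · exact (continuous_gaussian.smul ((continuous_translateLp hp g).comp
      (continuous_const_smul ρ))).aestronglyMeasurable
  · rw [norm_smul, norm_translateLp, Real.norm_of_nonneg (gaussian_pos y).le]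

variable {d : ℕ} {p : ℝ≥0∞} [Fact (1 ≤ p)] {X : Type*} [NormedAddCommGroup X] [NormedSpace ℂ X]
  [CompleteSpace X]

/-- The density on `(0, ∞) × ℝ^d` of the product of a Gamma distribution with a Gaussian. The
absolute value makes it nonnegative for all real `ω.1`. -/
def besselDensity (a : ℝ) (ω : ℝ × Rd d) : ℝ :=
  (Real.Gamma a)⁻¹ * (Real.exp (-ω.1) * |ω.1| ^ (a - 1)) * gaussian ω.2

/-- The displacement for which averaging `translateLp` against the Gaussian over the second variable
is the heat semigroup at time `t = ω.1`. -/
def heatShift (ω : ℝ × Rd d) : Rd d := (2 * √(Real.pi * ω.1)) • ω.2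

theorem continuous_heatShift : Continuous (heatShift (d := d)) := by
  unfold heatShift
  fun_prop

theorem integrableOn_gamma {a : ℝ} (ha : 0 < a) :
    IntegrableOn (fun t : ℝ ↦ Real.exp (-t) * |t| ^ (a - 1)) (Set.Ioi 0) := by
  refine (Real.GammaIntegral_convergent ha).congr_fun (fun t ht ↦ ?_) measurableSet_Ioi
  simp only [abs_of_pos (Set.mem_Ioi.mp ht)]

theorem integrable_besselDensity {a : ℝ} (ha : 0 < a) :
    Integrable (besselDensity (d := d) a)
      ((volume.restrict (Set.Ioi (0 : ℝ))).prod volume) :=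
  ((integrableOn_gamma ha).const_mul _).mul_prod integrable_gaussian

theorem besselDensity_nonneg {a : ℝ} (ha : 0 < a) (ω : ℝ × Rd d) : 0 ≤ besselDensity a ω := by
  have := (Real.Gamma_pos_of_pos ha).le
  have := (gaussian_pos ω.2).le
  unfold besselDensity
  positivity

theorem integral_besselDensity_mul_translationSymbol {a : ℝ} (ha : 0 < a) (ξ : Rd d) :
    ∫ ω, (besselDensity a ω : ℂ) * translationSymbol (heatShift ω) ξ
      ∂((volume.restrict (Set.Ioi (0 : ℝ))).prod volume) = besselSymbol d (-(2 * a)) ξ := by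
  have hint : Integrable (fun ω : ℝ × Rd d ↦
      (besselDensity a ω : ℂ) * translationSymbol (heatShift ω) ξ)
      ((volume.restrict (Set.Ioi (0 : ℝ))).prod volume) := by
    refine (integrable_besselDensity ha).ofReal.mul_bdd (c := 1) ?_
      (Filter.Eventually.of_forall fun ω ↦ (norm_translationSymbol _ _).le)
    exact (continuous_translationSymbol.comp
      (continuous_heatShift.prodMk continuous_const)).aestronglyMeasurable
  have hb : (0 : ℝ) < 1 + ‖(2 * Real.pi) • ξ‖ ^ 2 := by positivity
  have hG : Real.Gamma a ≠ 0 := (Real.Gamma_pos_of_pos ha).ne'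
  rw [integral_prod _ hint]
  have h1 : ∀ t ∈ Set.Ioi (0 : ℝ),
      ∫ y, (besselDensity a (t, y) : ℂ) * translationSymbol (heatShift (t, y)) ξ =
        (((Real.Gamma a)⁻¹ *
          (t ^ (a - 1) * Real.exp (-((1 + ‖(2 * Real.pi) • ξ‖ ^ 2) * t))) : ℝ) : ℂ) := by
    intro t ht
    have ht' : 0 < t := ht
    have h2 : gaussian ((2 * √(Real.pi * t)) • ξ) =
        Real.exp (-(‖(2 * Real.pi) • ξ‖ ^ 2 * t)) := by
      rw [gaussian, norm_smul, norm_smul, Real.norm_of_nonneg (by positivity),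
        Real.norm_of_nonneg (by positivity)]
      congr 1
      have := Real.sq_sqrt (mul_pos Real.pi_pos ht').le
      rw [mul_pow, mul_pow, this]
      ring
    simp only [besselDensity, heatShift, Complex.ofReal_mul, mul_assoc]
    simp only [← mul_assoc]
    simp only [mul_assoc _ (gaussian _ : ℂ), integral_const_mul]
    rw [integral_gaussian_mul_translationSymbol, h2]
    rw [abs_of_pos ht']
    norm_cast
    rw [add_mul, neg_add, Real.exp_add, one_mul]
    ring
  rw [setIntegral_congr_fun measurableSet_Ioi h1, integral_complex_ofReal, integral_const_mul,
    Real.integral_rpow_mul_exp_neg_mul_Ioi ha hb, besselSymbol]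
  congr 1
  rw [one_div, Real.inv_rpow hb.le, ← Real.rpow_neg hb.le]
  field_simp

theorem integral_besselDensity {a : ℝ} (ha : 0 < a) :
    ∫ ω, besselDensity (d := d) a ω ∂((volume.restrict (Set.Ioi (0 : ℝ))).prod volume) = 1 := by
  have h := integral_besselDensity_mul_translationSymbol (d := d) ha 0
  simp only [translationSymbol, inner_zero_right, mul_zero, Complex.ofReal_zero, zero_mul,
    Complex.exp_zero, mul_one, integral_complex_ofReal] at h
  simpa [besselSymbol] using h

/-- For `a > 0` the Bessel potential `(1 - Δ)^{-a}` is a contraction of `L^p(ℝ^d; X)`, being an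
average of translations: `(1 + |ξ|²)^{-a}` is the integral of `exp (-t |ξ|²)` against the density
`t^{a-1} exp (-t) / Γ(a)`. -/
theorem exists_bessel_average (hp : p ≠ ∞) {a : ℝ} (ha : 0 < a) :
    ∃ J : Lp X p (volume : Measure (Rd d)) →L[ℂ] Lp X p (volume : Measure (Rd d)),
      HasSymbol J (besselSymbol d (-(2 * a))) ∧ (∀ g, ‖J g‖ ≤ ‖g‖) ∧
      (∀ g : Lp X p (volume : Measure (Rd d)),
        Integrable (fun ω ↦ besselDensity a ω • translateLp (heatShift ω) g)
        ((volume.restrict (Set.Ioi (0 : ℝ))).prod volume)) ∧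
      ∀ g, J g = ∫ ω, besselDensity a ω • translateLp (heatShift ω) g
        ∂((volume.restrict (Set.Ioi (0 : ℝ))).prod volume) := by
  have hi := integrable_besselDensity (d := d) ha
  let F : ℝ × Rd d → Lp X p (volume : Measure (Rd d)) →L[ℂ] Lp X p (volume : Measure (Rd d)) :=
    fun ω ↦ (besselDensity a ω : ℂ) • translateLp (heatShift ω)
  have hFr : ∀ ω g, F ω g = besselDensity a ω • translateLp (heatShift ω) g :=
    fun ω g ↦ Complex.coe_smul (besselDensity a ω) (translateLp (heatShift ω) g)
  obtain ⟨h1, J, h2, h3⟩ := exists_strong_integral (F := F) hi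
    (fun g ↦ by
      simp only [hFr]
      exact hi.aestronglyMeasurable.smul
        ((continuous_translateLp hp g).comp continuous_heatShift).aestronglyMeasurable)
    (fun ω g ↦ by
      rw [hFr, norm_smul, norm_translateLp, Real.norm_of_nonneg (besselDensity_nonneg ha ω)])
  refine ⟨J, ?_, ?_, fun g ↦ ?_, fun g ↦ ?_⟩
  · rw [← funext (integral_besselDensity_mul_translationSymbol (d := d) ha)]
    refine HasSymbol.integral (b := besselDensity a) (F := F) (fun ω ↦ ?_) h1 h2 ?_ hi ?_
    · have := (HasSymbol.one (X := X) (p := p) (d := d)).translateLp_comp (heatShift ω)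
      simp only [mul_one] at this
      exact this.const_smul (besselDensity a ω : ℂ)
    · refine (Complex.continuous_ofReal.comp_aestronglyMeasurable
        hi.aestronglyMeasurable.comp_fst).mul ?_
      exact (continuous_translationSymbol.comp
        ((continuous_heatShift.comp continuous_fst).prodMk continuous_snd)).aestronglyMeasurable
    · intro ω ξ
      rw [norm_mul, norm_translationSymbol, mul_one, Complex.norm_real,
        Real.norm_of_nonneg (besselDensity_nonneg ha ω)]
  · intro g
    simpa [integral_besselDensity ha] using h3 g
  · simpa only [hFr] using h1 g
  · simpa only [hFr] using h2 g

/-- `(1 - Δ)^{-s/2}` as an operator on `L^p(ℝ^d; X)`, for `s ≥ 0`. -/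
theorem exists_bessel (hp : p ≠ ∞) {s : ℝ} (hs : 0 ≤ s) :
    ∃ J : Lp X p (volume : Measure (Rd d)) →L[ℂ] Lp X p (volume : Measure (Rd d)),
      HasSymbol J (besselSymbol d (-s)) ∧ ∀ g, ‖J g‖ ≤ ‖g‖ := by
  rcases hs.eq_or_lt with rfl | hs
  · refine ⟨1, ?_, fun g ↦ by simp⟩
    rw [neg_zero, besselSymbol_zero]
    exact HasSymbol.one
  · obtain ⟨J, h1, h2, -⟩ := exists_bessel_average (X := X) (d := d) hp (half_pos hs)
    exact ⟨J, by rwa [mul_div_cancel₀ s two_ne_zero] at h1, h2⟩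

/-- The heat semigroup at time proportional to `ρ²` maps `L^p` to functions with an `L^p` modulus
of continuity of order `|h| / ρ`: the translation can be moved to the Gaussian. -/
theorem norm_translateLp_heat_sub_le (hp : p ≠ ∞) {C : ℝ}
    (hC : ∀ v : Rd d, ∫ y, |gaussian (y - v) - gaussian y| ≤ C * ‖v‖) {ρ : ℝ} (hρ : 0 < ρ)
    (h : Rd d) (g : Lp X p (volume : Measure (Rd d))) :
    ‖translateLp h (∫ y : Rd d, gaussian y • translateLp (ρ • y) g) -
      ∫ y : Rd d, gaussian y • translateLp (ρ • y) g‖ ≤ C * ‖h‖ * ρ⁻¹ * ‖g‖ := by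
  have h1 : translateLp h (∫ y : Rd d, gaussian y • translateLp (ρ • y) g) =
      ∫ y : Rd d, gaussian (y - ρ⁻¹ • h) • translateLp (ρ • y) g := by
    rw [← ContinuousLinearMap.integral_comp_comm _ (integrable_heat hp ρ g),
      ← integral_add_right_eq_self
        (fun y ↦ gaussian (y - ρ⁻¹ • h) • translateLp (ρ • y) g) (ρ⁻¹ • h)]
    congr 1 with y
    rw [add_sub_cancel_right, ContinuousLinearMap.map_smul_of_tower, translateLp_translateLp,
      smul_add, smul_inv_smul₀ hρ.ne', add_comm]
  have h2 : Integrable fun y : Rd d ↦ gaussian (y - ρ⁻¹ • h) • translateLp (ρ • y) g := by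
    refine ((integrable_gaussian.comp_sub_right (ρ⁻¹ • h)).mul_const ‖g‖).mono' ?_
      (Filter.Eventually.of_forall fun y ↦ ?_)
    · exact ((continuous_gaussian.comp (continuous_sub_right _)).smul
        ((continuous_translateLp hp g).comp (continuous_const_smul ρ))).aestronglyMeasurable
    · rw [norm_smul, norm_translateLp, Real.norm_of_nonneg (gaussian_pos _).le]
  rw [h1, ← integral_sub h2 (integrable_heat hp ρ g)]
  simp only [← sub_smul]
  calc _ ≤ ∫ y, |gaussian (y - ρ⁻¹ • h) - gaussian y| * ‖g‖ := by
        refine (norm_integral_le_integral_norm _).trans_eq ?_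
        congr 1 with y
        rw [norm_smul, norm_translateLp, Real.norm_eq_abs]
    _ ≤ C * ‖ρ⁻¹ • h‖ * ‖g‖ := by
        rw [integral_mul_const]
        gcongr
        exact hC _
    _ = _ := by
        rw [norm_smul, Real.norm_of_nonneg (by positivity)]
        ring

/-- `(1 - Δ)^{-1}` maps `L^p` to functions with a Lipschitz `L^p` modulus of continuity. -/
theorem exists_bessel_two (hp : p ≠ ∞) :
    ∃ J : Lp X p (volume : Measure (Rd d)) →L[ℂ] Lp X p (volume : Measure (Rd d)),
      HasSymbol J (besselSymbol d (-2)) ∧ (∀ g, ‖J g‖ ≤ ‖g‖) ∧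
      ∃ C, 0 ≤ C ∧ ∀ h g, ‖translateLp h (J g) - J g‖ ≤ C * ‖h‖ * ‖g‖ := by
  obtain ⟨J, h1, h2, h3, h4⟩ := exists_bessel_average (X := X) (p := p) (d := d) hp one_pos
  rw [mul_one] at h1
  obtain ⟨C, hC0, hC⟩ := exists_integral_abs_gaussian_sub_le (d := d)
  have hI : IntegrableOn (fun t : ℝ ↦ Real.exp (-t) * (2 * √(Real.pi * t))⁻¹) (Set.Ioi 0) := by
    refine IntegrableOn.congr_fun
      ((Real.GammaIntegral_convergent (s := 1 / 2) (by norm_num)).mul_const (2 * √Real.pi)⁻¹)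
      (fun t ht ↦ ?_) measurableSet_Ioi
    have ht' : 0 < t := ht
    rw [Real.sqrt_mul Real.pi_pos.le, Real.sqrt_eq_rpow t,
      show (1 / 2 - 1 : ℝ) = -(1 / 2) by norm_num, Real.rpow_neg ht'.le]
    field_simp
  refine ⟨J, h1, h2, C * ∫ t in Set.Ioi (0 : ℝ), Real.exp (-t) * (2 * √(Real.pi * t))⁻¹,
    mul_nonneg hC0 (setIntegral_nonneg measurableSet_Ioi fun t _ ↦ by positivity), fun h g ↦ ?_⟩
  have h5 : J g = ∫ t in Set.Ioi (0 : ℝ),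
      Real.exp (-t) • ∫ y : Rd d, gaussian y • translateLp ((2 * √(Real.pi * t)) • y) g := by
    rw [h4, integral_prod _ (h3 g)]
    refine integral_congr_ae (Filter.Eventually.of_forall fun t ↦ ?_)
    simp only
    rw [← integral_smul]
    refine integral_congr_ae (Filter.Eventually.of_forall fun y ↦ ?_)
    simp [besselDensity, heatShift, smul_smul]
  have h6 : Integrable (fun t ↦
      Real.exp (-t) • ∫ y : Rd d, gaussian y • translateLp ((2 * √(Real.pi * t)) • y) g)
      (volume.restrict (Set.Ioi (0 : ℝ))) := by
    refine (h3 g).integral_prod_left.congr (Filter.Eventually.of_forall fun t ↦ ?_)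
    simp only
    rw [← integral_smul]
    refine integral_congr_ae (Filter.Eventually.of_forall fun y ↦ ?_)
    simp [besselDensity, heatShift, smul_smul]
  rw [h5, ← ContinuousLinearMap.integral_comp_comm _ h6,
    ← integral_sub ((translateLp h).integrable_comp h6) h6]
  have h7 : ∀ t ∈ Set.Ioi (0 : ℝ), ‖translateLp h (Real.exp (-t) •
        ∫ y : Rd d, gaussian y • translateLp ((2 * √(Real.pi * t)) • y) g) - Real.exp (-t) •
        ∫ y : Rd d, gaussian y • translateLp ((2 * √(Real.pi * t)) • y) g‖ ≤
      Real.exp (-t) * (2 * √(Real.pi * t))⁻¹ * (C * ‖h‖ * ‖g‖) := by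
    intro t ht
    have ht' : 0 < t := ht
    rw [ContinuousLinearMap.map_smul_of_tower, ← smul_sub, norm_smul,
      Real.norm_of_nonneg (Real.exp_pos _).le, mul_assoc]
    refine mul_le_mul_of_nonneg_left ?_ (Real.exp_pos _).le
    refine (norm_translateLp_heat_sub_le hp hC (by positivity) h g).trans_eq ?_
    ring
  refine (norm_integral_le_of_norm_le (hI.mul_const (C * ‖h‖ * ‖g‖))
    ((ae_restrict_iff' measurableSet_Ioi).mpr (Filter.Eventually.of_forall h7))).trans_eq ?_
  rw [integral_mul_const]
  ring

end Bessel

/-! ### The kernel of the fractional Laplacian -/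

section Kernel

variable {d : ℕ} {σ : ℝ}

/-- The kernel `|h|^{-d-σ}`. -/
def rieszKernel (σ : ℝ) (h : Rd d) : ℝ := (‖h‖ ^ ((d : ℝ) + σ))⁻¹

theorem rieszKernel_nonneg (h : Rd d) : 0 ≤ rieszKernel σ h := by
  unfold rieszKernel
  positivity

theorem measurable_rieszKernel : Measurable (rieszKernel (d := d) σ) := by
  unfold rieszKernel
  fun_prop

/-- The function `|h|^{-d-σ} min(1, |h|)` is integrable: this is where `0 < σ < 1` is used. -/
theorem integrable_rieszKernel_mul_min (hd : 1 ≤ d) (hσ : 0 < σ) (hσ1 : σ < 1) :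
    Integrable fun h : Rd d ↦ rieszKernel σ h * min 1 ‖h‖ := by
  have : Nonempty (Fin d) := ⟨⟨0, hd⟩⟩
  have hdim : Module.finrank ℝ (Rd d) = d := finrank_euclideanSpace_fin
  refine (integrable_fun_norm_addHaar (volume : Measure (Rd d))
    (f := fun y : ℝ ↦ (y ^ ((d : ℝ) + σ))⁻¹ * min 1 y)).mpr ?_
  rw [hdim, ← Set.Ioc_union_Ioi_eq_Ioi zero_le_one]
  have hpow : ∀ y : ℝ, 0 < y → y ^ (d - 1) * (y ^ ((d : ℝ) + σ))⁻¹ = y ^ (-1 - σ) := by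
    intro y hy
    rw [← Real.rpow_natCast, ← Real.rpow_neg hy.le, ← Real.rpow_add hy, Nat.cast_sub hd]
    congr 1
    push_cast
    ring
  refine IntegrableOn.union ?_ ?_
  · have h1 : IntegrableOn (fun y : ℝ ↦ y ^ (-σ)) (Set.Ioc 0 1) := by
      have := intervalIntegral.intervalIntegrable_rpow' (a := 0) (b := 1) (r := -σ) (by linarith)
      rwa [intervalIntegrable_iff_integrableOn_Ioc_of_le zero_le_one] at this
    refine h1.congr_fun (fun y hy ↦ ?_) measurableSet_Ioc
    simp only [smul_eq_mul]
    rw [← mul_assoc, hpow y hy.1, min_eq_right hy.2, ← Real.rpow_add_one hy.1.ne']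
    congr 1
    ring
  · have h1 : IntegrableOn (fun y : ℝ ↦ y ^ (-1 - σ)) (Set.Ioi 1) :=
      integrableOn_Ioi_rpow_of_lt (by linarith) one_pos
    refine h1.congr_fun (fun y hy ↦ ?_) measurableSet_Ioi
    have hy' : 1 < y := hy
    simp only [smul_eq_mul]
    rw [← mul_assoc, hpow y (by linarith), min_eq_left hy'.le, mul_one]

theorem norm_exp_inner_sub_one_le (h ξ : Rd d) :
    ‖Complex.exp (Complex.I * (inner ℝ h ξ : ℝ)) - 1‖ ≤ min 1 ‖h‖ * (2 + ‖ξ‖) := by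
  rcases le_total ‖h‖ 1 with hh | hh
  · rw [min_eq_right hh]
    calc _ ≤ ‖(inner ℝ h ξ : ℝ)‖ := Real.norm_exp_I_mul_ofReal_sub_one_le
      _ ≤ ‖h‖ * ‖ξ‖ := norm_inner_le_norm h ξ
      _ ≤ _ := by
        gcongr
        linarith
  · rw [min_eq_left hh, one_mul]
    refine (norm_sub_le _ _).trans ?_
    rw [mul_comm, Complex.norm_exp_ofReal_mul_I, norm_one]
    linarith [norm_nonneg ξ]

theorem integrable_exp_inner_sub_one_div (hd : 1 ≤ d) (hσ : 0 < σ) (hσ1 : σ < 1) (ξ : Rd d) :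
    Integrable fun h : Rd d ↦
      (Complex.exp (Complex.I * (inner ℝ h ξ : ℝ)) - 1) / (‖h‖ ^ ((d : ℝ) + σ) : ℝ) := by
  refine ((integrable_rieszKernel_mul_min hd hσ hσ1).mul_const (2 + ‖ξ‖)).mono' ?_
    (Filter.Eventually.of_forall fun h ↦ ?_)
  · apply Measurable.aestronglyMeasurable
    fun_prop
  · rw [norm_div, Complex.norm_real, Real.norm_of_nonneg (by positivity), div_eq_mul_inv, mul_comm,
      mul_assoc]
    exact mul_le_mul_of_nonneg_left (norm_exp_inner_sub_one_le h ξ) (rieszKernel_nonneg h)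

/-- The integral `∫ (cos ⟪h, ξ⟫ - 1) |h|^{-d-σ} dh`. -/
def cosIntegral (σ : ℝ) (ξ : Rd d) : ℝ :=
  ∫ h : Rd d, (Real.cos (inner ℝ h ξ) - 1) * rieszKernel σ h

theorem integral_exp_inner_sub_one_div (hd : 1 ≤ d) (hσ : 0 < σ) (hσ1 : σ < 1) (ξ : Rd d) :
    ∫ h : Rd d, (Complex.exp (Complex.I * (inner ℝ h ξ : ℝ)) - 1) / (‖h‖ ^ ((d : ℝ) + σ) : ℝ) =
      cosIntegral σ ξ := by
  have h1 := integrable_exp_inner_sub_one_div hd hσ hσ1 ξ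
  set F : Rd d → ℂ := fun h ↦
    (Complex.exp (Complex.I * (inner ℝ h ξ : ℝ)) - 1) / (‖h‖ ^ ((d : ℝ) + σ) : ℝ) with hF
  have h2 : ∫ h, F h = 2⁻¹ * ∫ h, (F h + F (-h)) := by
    rw [integral_add h1 h1.comp_neg, integral_neg_eq_self]
    ring
  rw [h2, cosIntegral, ← integral_complex_ofReal, ← integral_const_mul]
  congr 1 with h
  simp only [hF, rieszKernel, norm_neg, inner_neg_left]
  push_cast
  rw [Complex.cos, mul_neg, mul_comm Complex.I, neg_mul]
  ring

theorem integrable_cos_inner_sub_one_mul (hd : 1 ≤ d) (hσ : 0 < σ) (hσ1 : σ < 1) (ξ : Rd d) :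
    Integrable fun h : Rd d ↦ (Real.cos (inner ℝ h ξ) - 1) * rieszKernel σ h := by
  refine (integrable_exp_inner_sub_one_div hd hσ hσ1 ξ).re.congr
    (Filter.Eventually.of_forall fun h ↦ ?_)
  simp only [RCLike.re_to_complex]
  rw [Complex.div_ofReal_re, rieszKernel, div_eq_mul_inv, mul_comm Complex.I,
    Complex.sub_re, Complex.exp_ofReal_mul_I_re, Complex.one_re]

theorem cosIntegral_smul {r : ℝ} (hr : 0 < r) (ξ : Rd d) :
    cosIntegral σ (r • ξ) = r ^ σ * cosIntegral σ ξ := by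
  have h1 := Measure.integral_comp_smul (volume : Measure (Rd d))
    (fun h ↦ (Real.cos (inner ℝ h ξ) - 1) * rieszKernel σ h) r
  have h2 : ∀ h : Rd d, (Real.cos (inner ℝ (r • h) ξ) - 1) * rieszKernel σ (r • h) =
      (r ^ ((d : ℝ) + σ))⁻¹ * ((Real.cos (inner ℝ h (r • ξ)) - 1) * rieszKernel σ h) := by
    intro h
    rw [rieszKernel, rieszKernel, norm_smul, Real.norm_of_nonneg hr.le,
      Real.mul_rpow hr.le (norm_nonneg h), inner_smul_left, inner_smul_right, mul_inv]
    simp only [conj_trivial]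
    ring
  simp only [h2, integral_const_mul] at h1
  rw [finrank_euclideanSpace_fin, abs_of_pos (by positivity), smul_eq_mul, Real.rpow_add hr,
    Real.rpow_natCast] at h1
  change _ * cosIntegral σ (r • ξ) = _ * cosIntegral σ ξ at h1
  have h3 : 0 < r ^ d := by positivity
  have h4 : 0 < r ^ σ := by positivity
  field_simp at h1
  linarith

theorem cosIntegral_linearIsometryEquiv (A : Rd d ≃ₗᵢ[ℝ] Rd d) (ξ : Rd d) :
    cosIntegral σ (A ξ) = cosIntegral σ ξ := by
  rw [cosIntegral,
    ← A.measurePreserving.integral_comp A.toHomeomorph.measurableEmbedding]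
  simp only [A.inner_map_map, rieszKernel, A.norm_map, cosIntegral]

theorem cosIntegral_eq_of_norm_eq {ξ η : Rd d} (h : ‖ξ‖ = ‖η‖) :
    cosIntegral σ ξ = cosIntegral σ η := by
  rw [← Submodule.reflection_sub h, cosIntegral_linearIsometryEquiv]

theorem cosIntegral_neg (hd : 1 ≤ d) (hσ : 0 < σ) (hσ1 : σ < 1) {ξ : Rd d} (hξ : ξ ≠ 0) :
    cosIntegral σ ξ < 0 := by
  rw [← neg_pos, cosIntegral, ← integral_neg]
  have h0 : ∀ h : Rd d, 0 ≤ -((Real.cos (inner ℝ h ξ) - 1) * rieszKernel σ h) := by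
    intro h
    have := mul_nonneg (sub_nonneg.mpr (Real.cos_le_one (inner ℝ h ξ)))
      (rieszKernel_nonneg (σ := σ) h)
    linarith
  rw [integral_pos_iff_support_of_nonneg h0 (integrable_cos_inner_sub_one_mul hd hσ hσ1 ξ).neg]
  -- the integrand is positive near the point where the cosine equals `-1`
  have h1 : IsOpen {h : Rd d | Real.cos (inner ℝ h ξ) < 1 ∧ h ≠ 0} :=
    (isOpen_lt (f := fun h : Rd d ↦ Real.cos (inner ℝ h ξ)) (by fun_prop)
      continuous_const).inter isOpen_ne
  have h2 : ({h : Rd d | Real.cos (inner ℝ h ξ) < 1 ∧ h ≠ 0}).Nonempty := by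
    have hξ' : ‖ξ‖ ≠ 0 := norm_ne_zero_iff.mpr hξ
    refine ⟨(Real.pi / ‖ξ‖ ^ 2) • ξ, ?_, smul_ne_zero (by positivity) hξ⟩
    rw [inner_smul_left, real_inner_self_eq_norm_sq, conj_trivial,
      div_mul_cancel₀ _ (pow_ne_zero 2 hξ'), Real.cos_pi]
    norm_num
  refine (h1.measure_pos volume h2).trans_le (measure_mono fun h hh ↦ ?_)
  have h3 : 0 < rieszKernel σ h := by
    have := norm_pos_iff.mpr hh.2
    unfold rieszKernel
    positivity
  exact neg_ne_zero.mpr (mul_ne_zero (sub_neg.mpr hh.1).ne h3.ne')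

/-- The constant `c_{d,σ}` with `|ξ|^σ = c_{d,σ} ∫ (exp (i ⟪h, ξ⟫) - 1) |h|^{-d-σ} dh`: the integral
is homogeneous of degree `σ` and invariant under rotations. -/
theorem exists_rieszConstant (hd : 1 ≤ d) (hσ : 0 < σ) (hσ1 : σ < 1) :
    ∃ c : ℝ, c < 0 ∧ ∀ ξ : Rd d, ((‖ξ‖ ^ σ : ℝ) : ℂ) = c * ∫ h : Rd d,
      (Complex.exp (Complex.I * (inner ℝ h ξ : ℝ)) - 1) / (‖h‖ ^ ((d : ℝ) + σ) : ℝ) := by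
  have : Nonempty (Fin d) := ⟨⟨0, hd⟩⟩
  obtain ⟨e, he⟩ := exists_norm_eq (Rd d) zero_le_one
  have he0 : e ≠ 0 := by
    rintro rfl
    simp at he
  have hk := cosIntegral_neg hd hσ hσ1 he0
  refine ⟨(cosIntegral σ e)⁻¹, inv_neg''.mpr hk, fun ξ ↦ ?_⟩
  rw [integral_exp_inner_sub_one_div hd hσ hσ1]
  norm_cast
  rcases eq_or_ne ξ 0 with rfl | hξ
  · simp [cosIntegral, Real.zero_rpow hσ.ne']
  · have hξ' : 0 < ‖ξ‖ := norm_pos_iff.mpr hξ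
    have h1 : cosIntegral σ ξ = cosIntegral σ (‖ξ‖ • e) :=
      cosIntegral_eq_of_norm_eq (by rw [norm_smul, he, norm_norm, mul_one])
    rw [h1, cosIntegral_smul hξ', mul_comm, mul_assoc, mul_inv_cancel₀ hk.ne, mul_one]

end Kernel

/-! ### The operator with symbol `|ξ|^σ (1 + |ξ|²)^{-σ/2}` -/

section Binomial

theorem succ_mul_choose_succ (α : ℝ) (n : ℕ) :
    (n + 1) * Ring.choose α (n + 1) = (α - n) * Ring.choose α n := by
  have h : ((n.factorial : ℝ)) ≠ 0 := by exact_mod_cast n.factorial_ne_zero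
  rw [Ring.choose_eq_smul, Ring.choose_eq_smul, descPochhammer_succ_right, Polynomial.smeval_mul,
    Polynomial.smeval_sub, Polynomial.smeval_X, Polynomial.smeval_natCast, Nat.factorial_succ]
  simp only [smul_eq_mul, pow_one, pow_zero, nsmul_eq_mul, mul_one, Nat.cast_mul, Nat.cast_succ]
  field_simp

/-- The binomial series of exponent `α ∈ (0, 1)` converges absolutely on the closed unit disc, since
`α |choose α n| = n |choose α n| - (n + 1) |choose α (n + 1)|` telescopes. -/
theorem summable_abs_choose {α : ℝ} (hα : 0 < α) (hα1 : α < 1) :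
    Summable fun n : ℕ ↦ |Ring.choose α n| := by
  have hrec : ∀ n : ℕ, ((n : ℝ) + 1 + 1) * |Ring.choose α (n + 1 + 1)| =
      ((n : ℝ) + 1 - α) * |Ring.choose α (n + 1)| := by
    intro n
    have h := congrArg abs (succ_mul_choose_succ α (n + 1))
    have h1 : (0 : ℝ) < ((n + 1 : ℕ) : ℝ) - α := by
      push_cast
      linarith [n.cast_nonneg (α := ℝ)]
    rw [abs_mul, abs_mul, abs_of_pos (by positivity : (0 : ℝ) < ((n + 1 : ℕ) : ℝ) + 1),
      abs_sub_comm, abs_of_pos h1] at h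
    exact_mod_cast h
  have htel : ∀ N : ℕ, α * ∑ n ∈ Finset.range N, |Ring.choose α (n + 1)| +
      ((N : ℝ) + 1) * |Ring.choose α (N + 1)| = |Ring.choose α 1| := by
    intro N
    induction N with
    | zero => simp
    | succ N ih =>
      rw [Finset.sum_range_succ, Nat.cast_succ, hrec, ← ih]
      ring
  refine (summable_nat_add_iff 1).mp
    (summable_of_sum_range_le (c := |Ring.choose α 1| / α) (fun _ ↦ abs_nonneg _) fun N ↦ ?_)
  rw [le_div_iff₀ hα, ← htel N, mul_comm]
  exact le_add_of_nonneg_right (by positivity)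

theorem hasSum_choose_mul_neg_pow (α : ℝ) {x : ℝ} (hx0 : 0 ≤ x) (hx : x < 1) :
    HasSum (fun n : ℕ ↦ Ring.choose α n * (-1) ^ n * x ^ n) ((1 - x) ^ α) := by
  have h := (Real.one_add_rpow_hasFPowerSeriesOnBall_zero (a := α)).hasSum (y := -x)
    (by simpa [Metric.mem_eball, edist_dist, abs_of_nonneg hx0] using hx)
  rw [zero_add, ← sub_eq_add_neg] at h
  convert! h using 2 with n
  rw [binomialSeries_apply, List.ofFn_const, List.prod_replicate, smul_eq_mul, neg_pow]
  ring

end Binomial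

section FracSymbol

variable {d : ℕ} {p : ℝ≥0∞} [Fact (1 ≤ p)] {X : Type*} [NormedAddCommGroup X] [NormedSpace ℂ X]
  [CompleteSpace X]

theorem continuous_besselSymbol (s : ℝ) : Continuous (besselSymbol d s) := by
  unfold besselSymbol
  refine Complex.continuous_ofReal.comp (Continuous.rpow_const (by fun_prop) fun ξ ↦ Or.inl ?_)
  positivity

theorem norm_besselSymbol_le_one {s : ℝ} (hs : s ≤ 0) (ξ : Rd d) : ‖besselSymbol d s ξ‖ ≤ 1 := by
  have h : (1 : ℝ) ≤ 1 + ‖(2 * Real.pi) • ξ‖ ^ 2 := le_add_of_nonneg_right (by positivity)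
  rw [besselSymbol, Complex.norm_real, Real.norm_of_nonneg (by positivity)]
  exact Real.rpow_le_one_of_one_le_of_nonpos h (by linarith)

/-- The symbol of `(1 - Δ)^{-σ/2} (-Δ)^{σ/2}`. -/
def fracSymbol (d : ℕ) (σ : ℝ) (ξ : Rd d) : ℂ :=
  ((‖(2 * Real.pi) • ξ‖ ^ σ : ℝ) : ℂ) * besselSymbol d (-σ) ξ

theorem norm_fracSymbol_le_one {σ : ℝ} (hσ : 0 ≤ σ) (ξ : Rd d) : ‖fracSymbol d σ ξ‖ ≤ 1 := by
  set r := ‖(2 * Real.pi) • ξ‖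
  have hr : 0 ≤ r := norm_nonneg _
  have h1 : 0 < 1 + r ^ 2 := by positivity
  rw [fracSymbol, besselSymbol, norm_mul, Complex.norm_real, Complex.norm_real,
    Real.norm_of_nonneg (by positivity), Real.norm_of_nonneg (by positivity), neg_div,
    Real.rpow_neg h1.le, ← div_eq_mul_inv]
  refine div_le_one_of_le₀ ?_ (by positivity)
  calc r ^ σ = (r ^ 2) ^ (σ / 2) := by
        rw [← Real.rpow_natCast, ← Real.rpow_mul hr]
        congr 1
        push_cast
        ring
    _ ≤ _ := Real.rpow_le_rpow (by positivity) (by linarith) (by positivity)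

theorem hasSum_fracSymbol {σ : ℝ} {ξ : Rd d} (hξ : ξ ≠ 0) :
    HasSum (fun n : ℕ ↦ ((Ring.choose (σ / 2) n * (-1) ^ n : ℝ) : ℂ) *
      besselSymbol d (-(2 * n)) ξ) (fracSymbol d σ ξ) := by
  set r := ‖(2 * Real.pi) • ξ‖ with hr_def
  have hr : 0 < r := norm_pos_iff.mpr (smul_ne_zero (by positivity) hξ)
  have h1 : 0 < 1 + r ^ 2 := by positivity
  have h := hasSum_choose_mul_neg_pow (σ / 2) (x := (1 + r ^ 2)⁻¹) (by positivity)
    (inv_lt_one_of_one_lt₀ (by linarith [pow_pos hr 2]))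
  convert! Complex.hasSum_ofReal.mpr h using 1
  · funext n
    rw [Complex.ofReal_mul _ ((1 + r ^ 2)⁻¹ ^ n), besselSymbol, ← hr_def, neg_div,
      mul_div_cancel_left₀ _ two_ne_zero, Real.rpow_neg h1.le, Real.rpow_natCast, inv_pow]
  · rw [fracSymbol, besselSymbol, ← hr_def, ← Complex.ofReal_mul]
    congr 1
    rw [show 1 - (1 + r ^ 2)⁻¹ = r ^ 2 / (1 + r ^ 2) by field_simp; ring,
      Real.div_rpow (by positivity) h1.le, neg_div, Real.rpow_neg h1.le, ← Real.rpow_natCast r 2,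
      ← Real.rpow_mul hr.le, div_eq_mul_inv]
    congr 2
    push_cast
    ring

/-- The operator with symbol `|ξ|^σ (1 + |ξ|²)^{-σ/2}` is bounded on `L^p(ℝ^d; X)`: it is the
absolutely convergent binomial series of `(1 - (1 - Δ)^{-1})^{σ/2}`. -/
theorem exists_hasSymbol_fracSymbol (hd : 1 ≤ d) (hp : p ≠ ∞) {σ : ℝ} (hσ : 0 < σ) (hσ1 : σ < 1) :
    ∃ M : Lp X p (volume : Measure (Rd d)) →L[ℂ] Lp X p (volume : Measure (Rd d)),
      HasSymbol M (fracSymbol d σ) := by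
  have : Nonempty (Fin d) := ⟨⟨0, hd⟩⟩
  choose J hJ hJ1 using fun n : ℕ ↦
    exists_bessel (X := X) (d := d) hp (s := 2 * n) (by positivity)
  let a : ℕ → ℝ := fun n ↦ Ring.choose (σ / 2) n * (-1) ^ n
  have ha : Summable fun n ↦ ‖a n‖ := by
    refine (summable_abs_choose (half_pos hσ) (by linarith : σ / 2 < 1)).congr fun n ↦ ?_
    simp [a]
  have hai : Integrable (fun n ↦ ‖a n‖) (Measure.count : Measure ℕ) :=
    integrable_count_iff.mpr (by simpa using ha)
  obtain ⟨h1, M, h2, -⟩ := exists_strong_integral (F := fun n ↦ (a n : ℂ) • J n) hai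
    (fun g ↦ by fun_prop)
    (fun n g ↦ by
      rw [smul_apply, norm_smul, Complex.norm_real]
      gcongr
      exact hJ1 n g)
  have hk : ∀ (n : ℕ) (ξ : Rd d), ‖(a n : ℂ) * besselSymbol d (-(2 * n)) ξ‖ ≤ ‖a n‖ := by
    intro n ξ
    rw [norm_mul, Complex.norm_real]
    refine mul_le_of_le_one_right (norm_nonneg _) (norm_besselSymbol_le_one ?_ ξ)
    exact neg_nonpos.mpr (by positivity)
  have hM := HasSymbol.integral (k := fun n ξ ↦ (a n : ℂ) * besselSymbol d (-(2 * n)) ξ)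
    (fun n ↦ (hJ n).const_smul (a n : ℂ)) h1 h2 ?_ hai hk
  · refine ⟨M, hM.congr_ae ?_ ⟨1, norm_fracSymbol_le_one hσ.le⟩⟩
    filter_upwards [compl_mem_ae_iff.mpr (measure_singleton (0 : Rd d))] with ξ hξ
    rw [integral_countable]
    · simpa [a] using (hasSum_fracSymbol (σ := σ) hξ).tsum_eq
    · exact hai.mono' (by fun_prop) (Filter.Eventually.of_forall fun n ↦ hk n ξ)
  · apply Measurable.aestronglyMeasurable
    exact measurable_from_prod_countable_right fun n ↦
      ((continuous_besselSymbol (-(2 * (n : ℝ)))).const_mul (a n : ℂ)).measurable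

end FracSymbol

/-! ### Integrals of differences against the kernel -/

section DiffIntegral

variable {d : ℕ} {p : ℝ≥0∞} [Fact (1 ≤ p)] {X : Type*} [NormedAddCommGroup X] [NormedSpace ℂ X]
  [CompleteSpace X] {σ : ℝ}

/-- If the differences of `B g` are dominated by `K`, then `∫_A |h|^{-d-σ} (τ_h - 1) B dh` is an
operator with a symbol. -/
theorem exists_diffIntegral (hp : p ≠ ∞)
    {B : Lp X p (volume : Measure (Rd d)) →L[ℂ] Lp X p (volume : Measure (Rd d))} {m : Rd d → ℂ}
    (hB : HasSymbol B m) {A : Set (Rd d)} {K : Rd d → ℝ}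
    (hK : IntegrableOn (fun h ↦ rieszKernel σ h * K h) A)
    (hBK : ∀ h g, ‖translateLp h (B g) - B g‖ ≤ K h * ‖g‖)
    (hmK : ∀ h ξ, ‖(translationSymbol h ξ - 1) * m ξ‖ ≤ K h) :
    (∀ g, IntegrableOn (fun h ↦ rieszKernel σ h • (translateLp h (B g) - B g)) A) ∧
    ∃ T : Lp X p (volume : Measure (Rd d)) →L[ℂ] Lp X p (volume : Measure (Rd d)),
      (∀ g, T g = ∫ h in A, rieszKernel σ h • (translateLp h (B g) - B g)) ∧
      HasSymbol T fun ξ ↦ ∫ h in A,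
        (rieszKernel σ h : ℂ) * ((translationSymbol h ξ - 1) * m ξ) := by
  let F : Rd d → Lp X p (volume : Measure (Rd d)) →L[ℂ] Lp X p (volume : Measure (Rd d)) :=
    fun h ↦ (rieszKernel σ h : ℂ) • ((translateLp h).comp B - B)
  have hF : ∀ h g, F h g = rieszKernel σ h • (translateLp h (B g) - B g) :=
    fun h g ↦ Complex.coe_smul (rieszKernel σ h) (translateLp h (B g) - B g)
  obtain ⟨h1, T, h2, -⟩ := exists_strong_integral (F := F) hK
    (fun g ↦ by
      simp only [hF]
      exact measurable_rieszKernel.aestronglyMeasurable.smul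
        ((continuous_translateLp hp (B g)).sub continuous_const).aestronglyMeasurable)
    (fun h g ↦ by
      rw [hF, norm_smul, Real.norm_of_nonneg (rieszKernel_nonneg h), mul_assoc]
      exact mul_le_mul_of_nonneg_left (hBK h g) (rieszKernel_nonneg h))
  refine ⟨fun g ↦ by simpa only [hF, IntegrableOn] using h1 g, T,
    fun g ↦ by simpa only [hF] using h2 g, ?_⟩
  refine HasSymbol.integral (F := F) (fun h ↦ ?_) h1 h2 ?_ hK fun h ξ ↦ ?_
  · have h3 := ((hB.translateLp_comp h).sub hB).const_smul (rieszKernel σ h : ℂ)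
    simpa only [sub_mul, one_mul] using h3
  · have h3 : Measurable fun z : Rd d × Rd d ↦ (rieszKernel σ z.1 : ℂ) :=
      Complex.measurable_ofReal.comp (measurable_rieszKernel.comp measurable_fst)
    have h4 := continuous_translationSymbol (d := d)
    exact h3.aestronglyMeasurable.mul ((h4.aestronglyMeasurable.sub
      aestronglyMeasurable_const).mul hB.aestronglyMeasurable.comp_snd)
  · rw [norm_mul, Complex.norm_real, Real.norm_of_nonneg (rieszKernel_nonneg h)]
    exact mul_le_mul_of_nonneg_left (hmK h ξ) (rieszKernel_nonneg h)

theorem measurableSet_annulus (r R : ℝ) : MeasurableSet (annulus d r R) :=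
  ((isOpen_lt continuous_const continuous_norm).inter
    (isOpen_lt continuous_norm continuous_const)).measurableSet

theorem annulus_subset_closedBall (r R : ℝ) : annulus d r R ⊆ Metric.closedBall 0 R :=
  fun _ hh ↦ mem_closedBall_zero_iff.mpr hh.2.le

theorem volume_annulus_lt_top (r R : ℝ) : volume (annulus d r R) < ∞ :=
  (measure_mono (annulus_subset_closedBall r R)).trans_lt measure_closedBall_lt_top

theorem rieszKernel_le_of_mem_annulus (hσ : 0 ≤ σ) {r R : ℝ} (hr : 0 < r) {h : Rd d}
    (hh : h ∈ annulus d r R) : rieszKernel σ h ≤ (r ^ ((d : ℝ) + σ))⁻¹ :=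
  inv_anti₀ (by positivity) (Real.rpow_le_rpow hr.le hh.1.le (by positivity))

theorem integrableOn_rieszKernel_annulus (hσ : 0 ≤ σ) {r R : ℝ} (hr : 0 < r) :
    IntegrableOn (rieszKernel σ) (annulus d r R) := by
  refine Measure.integrableOn_of_bounded (M := (r ^ ((d : ℝ) + σ))⁻¹) (volume_annulus_lt_top r R).ne
    measurable_rieszKernel.aestronglyMeasurable
    (ae_restrict_of_forall_mem (measurableSet_annulus r R) fun h hh ↦ ?_)
  rw [Real.norm_of_nonneg (rieszKernel_nonneg h)]
  exact rieszKernel_le_of_mem_annulus hσ hr hh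

/-- On an annulus no smoothing is needed. -/
theorem exists_diffIntegral_annulus (hp : p ≠ ∞) (hσ : 0 ≤ σ)
    {B : Lp X p (volume : Measure (Rd d)) →L[ℂ] Lp X p (volume : Measure (Rd d))} {m : Rd d → ℂ}
    (hB : HasSymbol B m) (hB1 : ∀ g, ‖B g‖ ≤ ‖g‖) (hm : ∀ ξ, ‖m ξ‖ ≤ 1) {r R : ℝ} (hr : 0 < r) :
    (∀ g, IntegrableOn (fun h ↦ rieszKernel σ h • (translateLp h (B g) - B g))
      (annulus d r R)) ∧
    ∃ T : Lp X p (volume : Measure (Rd d)) →L[ℂ] Lp X p (volume : Measure (Rd d)),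
      (∀ g, T g = ∫ h in annulus d r R, rieszKernel σ h • (translateLp h (B g) - B g)) ∧
      HasSymbol T fun ξ ↦ ∫ h in annulus d r R,
        (rieszKernel σ h : ℂ) * ((translationSymbol h ξ - 1) * m ξ) := by
  refine exists_diffIntegral hp hB (K := fun _ ↦ 2)
    ((integrableOn_rieszKernel_annulus hσ hr).mul_const 2) (fun h g ↦ ?_) fun h ξ ↦ ?_
  · refine (norm_sub_le _ _).trans ?_
    rw [norm_translateLp]
    linarith [hB1 g]
  · rw [norm_mul]
    have h1 : ‖translationSymbol h ξ - 1‖ ≤ 2 := by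
      refine (norm_sub_le _ _).trans ?_
      rw [norm_translationSymbol, norm_one]
      norm_num
    nlinarith [hm ξ, norm_nonneg (m ξ)]

theorem translationSymbol_eq (h ξ : Rd d) :
    translationSymbol h ξ =
      Complex.exp (Complex.I * (inner ℝ h ((2 * Real.pi) • ξ) : ℝ)) := by
  rw [translationSymbol, inner_smul_right, mul_comm]

theorem norm_translationSymbol_sub_one_mul_besselSymbol_le (h ξ : Rd d) :
    ‖(translationSymbol h ξ - 1) * besselSymbol d (-2) ξ‖ ≤ 3 * min 1 ‖h‖ := by
  set r := ‖(2 * Real.pi) • ξ‖ with hr_def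
  have hr : 0 ≤ r := norm_nonneg _
  have h1 := norm_exp_inner_sub_one_le h ((2 * Real.pi) • ξ)
  rw [← translationSymbol_eq, ← hr_def] at h1
  have h2 : ‖besselSymbol d (-2) ξ‖ = (1 + r ^ 2)⁻¹ := by
    rw [besselSymbol, Complex.norm_real, Real.norm_of_nonneg (by positivity), ← hr_def,
      show (-2 / 2 : ℝ) = -1 by norm_num, Real.rpow_neg_one]
  rw [norm_mul, h2]
  calc _ ≤ min 1 ‖h‖ * (2 + r) * (1 + r ^ 2)⁻¹ := by gcongr
    _ = min 1 ‖h‖ * ((2 + r) / (1 + r ^ 2)) := by ring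
    _ ≤ min 1 ‖h‖ * 3 := by
      gcongr
      rw [div_le_iff₀ (by positivity)]
      nlinarith [sq_nonneg (r - 1)]
    _ = _ := mul_comm _ _

/-- Smoothed by `(1 - Δ)^{-1}`, the singular integral converges absolutely in `L^p`; up to the
factor `c` it has the symbol `|ξ|^σ (1 + |ξ|²)^{-1}`, and its truncations converge to it. -/
theorem exists_smoothed_singular_integral (hd : 1 ≤ d) (hp : p ≠ ∞) (hσ : 0 < σ) (hσ1 : σ < 1)
    {c : ℝ} (hc : ∀ ξ : Rd d, ((‖ξ‖ ^ σ : ℝ) : ℂ) = c * ∫ h : Rd d,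
      (Complex.exp (Complex.I * (inner ℝ h ξ : ℝ)) - 1) / (‖h‖ ^ ((d : ℝ) + σ) : ℝ)) :
    ∃ (S : Lp X p (volume : Measure (Rd d)) →L[ℂ] Lp X p (volume : Measure (Rd d)))
      (S' : ℝ → ℝ → Lp X p (volume : Measure (Rd d)) →L[ℂ] Lp X p (volume : Measure (Rd d))),
      HasSymbol ((c : ℂ) • S) (fun ξ ↦ besselSymbol d (σ - 2) ξ * fracSymbol d σ ξ) ∧
      (∀ r R, HasSymbol (S' r R) fun ξ ↦ ∫ h in annulus d r R,
        (rieszKernel σ h : ℂ) * ((translationSymbol h ξ - 1) * besselSymbol d (-2) ξ)) ∧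
      ∀ g, Filter.Tendsto (fun q : ℝ × ℝ ↦ S' q.1 q.2 g)
        (𝓝[>] (0 : ℝ) ×ˢ Filter.atTop) (𝓝 (S g)) := by
  obtain ⟨J, hJ, hJ1, C, hC0, hC⟩ := exists_bessel_two (X := X) (d := d) hp
  have hJK : ∀ h g, ‖translateLp h (J g) - J g‖ ≤ (C + 3) * min 1 ‖h‖ * ‖g‖ := by
    intro h g
    rcases le_total ‖h‖ 1 with hh | hh
    · rw [min_eq_right hh]
      refine (hC h g).trans ?_
      gcongr
      linarith
    · rw [min_eq_left hh, mul_one]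
      refine (norm_sub_le _ _).trans ?_
      rw [norm_translateLp]
      nlinarith [hJ1 g, norm_nonneg g]
  have hmK : ∀ h ξ : Rd d,
      ‖(translationSymbol h ξ - 1) * besselSymbol d (-2) ξ‖ ≤ (C + 3) * min 1 ‖h‖ := by
    intro h ξ
    refine (norm_translationSymbol_sub_one_mul_besselSymbol_le h ξ).trans ?_
    gcongr
    linarith
  have hK : Integrable fun h : Rd d ↦ rieszKernel σ h * ((C + 3) * min 1 ‖h‖) := by
    refine ((integrable_rieszKernel_mul_min hd hσ hσ1).const_mul (C + 3)).congr
      (Filter.Eventually.of_forall fun h ↦ ?_)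
    ring
  have hex := fun A : Set (Rd d) ↦ exists_diffIntegral hp hJ (hK.integrableOn (s := A)) hJK hmK
  obtain ⟨hi, S, hS, hSm⟩ := hex Set.univ
  choose S' hS' hSm' using fun r R ↦ (hex (annulus d r R)).2
  simp only [Measure.restrict_univ, integrableOn_univ] at hi hS hSm
  refine ⟨S, S', ?_, hSm', fun g ↦ ?_⟩
  · convert! hSm.const_smul (c : ℂ) using 1
    funext ξ
    have h1 : ∀ h : Rd d,
        (rieszKernel σ h : ℂ) * ((translationSymbol h ξ - 1) * besselSymbol d (-2) ξ) =
        (Complex.exp (Complex.I * (inner ℝ h ((2 * Real.pi) • ξ) : ℝ)) - 1) /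
          (‖h‖ ^ ((d : ℝ) + σ) : ℝ) * besselSymbol d (-2) ξ := by
      intro h
      rw [← translationSymbol_eq, rieszKernel, Complex.ofReal_inv, div_eq_mul_inv]
      ring
    simp only [h1]
    rw [integral_mul_const, ← mul_assoc, ← hc, fracSymbol, mul_left_comm]
    congr 1
    have h2 := congrFun (besselSymbol_mul d (σ - 2) (-σ)) ξ
    rw [Pi.mul_apply] at h2
    rw [h2]
    congr 1
    ring
  · simp only [hS, hS']
    have h1 : ∀ q : ℝ × ℝ, ∫ h in annulus d q.1 q.2,
        rieszKernel σ h • (translateLp h (J g) - J g) = ∫ h, (annulus d q.1 q.2).indicator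
          (fun h ↦ rieszKernel σ h • (translateLp h (J g) - J g)) h :=
      fun q ↦ (integral_indicator (measurableSet_annulus q.1 q.2)).symm
    simp only [h1]
    refine tendsto_integral_filter_of_dominated_convergence
      (fun h ↦ ‖rieszKernel σ h • (translateLp h (J g) - J g)‖)
      (Filter.Eventually.of_forall fun q ↦
        (hi g).aestronglyMeasurable.indicator (measurableSet_annulus q.1 q.2))
      (Filter.Eventually.of_forall fun q ↦ Filter.Eventually.of_forall fun h ↦
        norm_indicator_le_norm_self _ h) (hi g).norm ?_
    have : Nonempty (Fin d) := ⟨⟨0, hd⟩⟩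
    filter_upwards [compl_mem_ae_iff.mpr (measure_singleton (0 : Rd d))] with h hh
    refine tendsto_const_nhds.congr' ?_
    have hh0 : 0 < ‖h‖ := norm_pos_iff.mpr hh
    have h2 : ∀ᶠ r in 𝓝[>] (0 : ℝ), r < ‖h‖ :=
      Filter.Eventually.filter_mono nhdsWithin_le_nhds (eventually_lt_nhds hh0)
    filter_upwards [h2.prod_mk (Filter.eventually_gt_atTop ‖h‖)] with q hq
    have h3 : h ∈ annulus d q.1 q.2 := ⟨hq.1, hq.2⟩
    rw [Set.indicator_of_mem h3]

end DiffIntegral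

/-! ### The truncated integrals as elements of `L^p` -/

section TruncInt

variable {d : ℕ} {X : Type*} [NormedAddCommGroup X] [NormedSpace ℂ X] {σ : ℝ} {f : Rd d → X}

theorem integrableOn_diffQuot_annulus (hf : LocallyIntegrable f) (hσ : 0 ≤ σ) {r : ℝ} (hr : 0 < r)
    (R : ℝ) (x : Rd d) : IntegrableOn (diffQuot σ f x) (annulus d r R) := by
  have h1 : IntegrableOn (fun h ↦ f (x + h)) (annulus d r R) := by
    have h2 := ((measurePreserving_add_left (volume : Measure (Rd d)) x).integrableOn_comp_preimage
      (measurableEmbedding_addLeft x) (s := Metric.closedBall x R)).mpr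
        (hf.integrableOn_isCompact (isCompact_closedBall x R))
    refine h2.mono_set fun h hh ↦ ?_
    simpa using hh.2.le
  have h3 : IntegrableOn (fun h ↦ f (x + h) - f x) (annulus d r R) :=
    h1.sub (integrableOn_const (volume_annulus_lt_top r R).ne)
  refine h3.bdd_smul (φ := rieszKernel σ) (r ^ ((d : ℝ) + σ))⁻¹
    measurable_rieszKernel.aestronglyMeasurable
    (ae_restrict_of_forall_mem (measurableSet_annulus r R) fun h hh ↦ ?_)
  rw [Real.norm_of_nonneg (rieszKernel_nonneg h)]
  exact rieszKernel_le_of_mem_annulus hσ hr hh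

theorem integrableOn_comp_add_prod {d : ℕ} {X : Type*} [NormedAddCommGroup X] {f : Rd d → X}
    (hf : LocallyIntegrable f) {K : Set (Rd d)} (hK : IsCompact K) (r R : ℝ) :
    IntegrableOn (fun z : Rd d × Rd d ↦ f (z.1 + z.2)) (K ×ˢ annulus d r R)
      (volume.prod volume) := by
  have : IsFiniteMeasure (volume.restrict K) := isFiniteMeasure_restrict.mpr hK.measure_lt_top.ne
  obtain ⟨ρ, hρ⟩ := hK.isBounded.subset_closedBall 0
  -- the shear `(x, h) ↦ (x, x + h)` preserves the measure and maps `K × A` into a bounded set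
  have : IsFiniteMeasure (volume.restrict (Metric.closedBall (0 : Rd d) (ρ + R))) :=
    isFiniteMeasure_restrict.mpr measure_closedBall_lt_top.ne
  have h2 : IntegrableOn (fun z : Rd d × Rd d ↦ f z.2)
      (K ×ˢ Metric.closedBall 0 (ρ + R)) (volume.prod volume) := by
    rw [IntegrableOn, ← Measure.prod_restrict]
    exact (hf.integrableOn_isCompact (isCompact_closedBall 0 (ρ + R))).comp_snd _
  have h3 := ((measurePreserving_prod_add (volume : Measure (Rd d))
    (volume : Measure (Rd d))).integrableOn_comp_preimage
    (MeasurableEquiv.shearAddRight (Rd d)).measurableEmbedding).mpr h2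
  refine h3.mono_set fun z hz ↦ ⟨hz.1, ?_⟩
  have h4 := mem_closedBall_zero_iff.mp (hρ hz.1)
  exact mem_closedBall_zero_iff.mpr ((norm_add_le _ _).trans (add_le_add h4 hz.2.2.le))

theorem integrable_diffQuot_prod (hf : LocallyIntegrable f) (hσ : 0 ≤ σ) {r : ℝ} (hr : 0 < r)
    (R : ℝ) {K : Set (Rd d)} (hK : IsCompact K) :
    Integrable (Function.uncurry (diffQuot σ f))
      ((volume.restrict K).prod (volume.restrict (annulus d r R))) := by
  have hKf : volume K < ∞ := hK.measure_lt_top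
  have hAf := volume_annulus_lt_top (d := d) r R
  have hA := measurableSet_annulus (d := d) r R
  have : IsFiniteMeasure (volume.restrict K) := isFiniteMeasure_restrict.mpr hKf.ne
  have : IsFiniteMeasure (volume.restrict (annulus d r R)) := isFiniteMeasure_restrict.mpr hAf.ne
  have h1 := integrableOn_comp_add_prod hf hK r R
  have h5 : Integrable (fun z : Rd d × Rd d ↦ f (z.1 + z.2) - f z.1)
      ((volume.restrict K).prod (volume.restrict (annulus d r R))) := by
    refine Integrable.sub ?_ ((hf.integrableOn_isCompact hK).comp_fst _)
    rwa [IntegrableOn, ← Measure.prod_restrict] at h1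
  have h6 : Measurable fun z : Rd d × Rd d ↦ rieszKernel σ z.2 :=
    measurable_rieszKernel.comp measurable_snd
  have h7 : ∀ᵐ z ∂(volume.restrict K).prod (volume.restrict (annulus d r R)),
      ‖rieszKernel σ z.2‖ ≤ (r ^ ((d : ℝ) + σ))⁻¹ := by
    rw [Measure.prod_restrict]
    refine ae_restrict_of_forall_mem (hK.measurableSet.prod hA) fun z hz ↦ ?_
    rw [Real.norm_of_nonneg (rieszKernel_nonneg z.2)]
    exact rieszKernel_le_of_mem_annulus hσ hr hz.2
  refine (h5.bdd_smul (φ := fun z ↦ rieszKernel σ z.2) (r ^ ((d : ℝ) + σ))⁻¹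
    h6.aestronglyMeasurable h7).congr (Filter.Eventually.of_forall fun z ↦ ?_)
  rfl

theorem locallyIntegrable_truncInt (hf : LocallyIntegrable f) (hσ : 0 ≤ σ) {r : ℝ} (hr : 0 < r)
    (R : ℝ) : LocallyIntegrable (truncInt σ r R f) :=
  locallyIntegrable_iff.mpr fun _ hK ↦ (integrable_diffQuot_prod hf hσ hr R hK).integral_prod_left

variable {p : ℝ≥0∞} [Fact (1 ≤ p)] [CompleteSpace X]

/-- The pointwise truncated integral of `f` is the Bochner integral in `L^p(ℝ^d; X)` of the
differences `τ_h f - f` against the kernel, as both have the same integrals against test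
functions. -/
theorem truncInt_ae_eq (hσ : 0 ≤ σ) {r : ℝ} (hr : 0 < r) (R : ℝ)
    {F : Lp X p (volume : Measure (Rd d))}
    (hfF : f =ᵐ[volume] F)
    (hi : IntegrableOn (fun h ↦ rieszKernel σ h • (translateLp h F - F)) (annulus d r R)) :
    truncInt σ r R f =ᵐ[volume]
      (∫ h in annulus d r R, rieszKernel σ h • (translateLp h F - F) :
        Lp X p (volume : Measure (Rd d))) := by
  have hp1 : 1 ≤ p := Fact.out
  have hf : LocallyIntegrable f :=
    (((Lp.memLp F).ae_eq hfF.symm).locallyIntegrable hp1)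
  refine ae_eq_of_integral_contDiff_smul_eq (locallyIntegrable_truncInt hf hσ hr R)
    ((Lp.memLp _).locallyIntegrable hp1) fun g hg hgc ↦ ?_
  have hg1 : HasCompactSupport (Complex.ofRealCLM ∘ g) := hgc.comp_left rfl
  have hg2 : ContDiff ℝ _ (Complex.ofRealCLM ∘ g) := Complex.ofRealCLM.contDiff.comp hg
  let ψ : 𝓢(Rd d, ℂ) := hg1.toSchwartzMap hg2
  have hψ : ∀ (x : Rd d) (v : X), ψ x • v = g x • v := fun x v ↦ Complex.coe_smul (g x) v
  set K := tsupport g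
  have hK : IsCompact K := hgc
  have hsupp : ∀ u : Rd d → X, ∫ x in K, g x • u x = ∫ x, g x • u x := fun u ↦
    setIntegral_eq_integral_of_forall_compl_eq_zero fun x hx ↦ by
      rw [image_eq_zero_of_notMem_tsupport hx, zero_smul]
  have hR : ∫ x, g x • (∫ h in annulus d r R, rieszKernel σ h • (translateLp h F - F) :
      Lp X p (volume : Measure (Rd d))) x = ∫ h in annulus d r R, ∫ x in K,
        g x • diffQuot σ f x h := by
    simp only [← hψ]
    rw [← lpPairing_apply, ← ContinuousLinearMap.integral_comp_comm _ hi]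
    congr 1 with h
    simp only [hψ]
    rw [hsupp, lpPairing_apply]
    apply integral_congr_ae
    have h1 := (measurePreserving_add_right (volume : Measure (Rd d)) h).quasiMeasurePreserving.ae
      hfF
    filter_upwards [Lp.coeFn_smul (rieszKernel σ h) (translateLp h F - F),
      Lp.coeFn_sub (translateLp h F) F, coeFn_translateLp h F, h1, hfF] with x h2 h3 h4 h5 h6
    rw [hψ, h2, Pi.smul_apply, h3, Pi.sub_apply, h4, ← h5, ← h6]
    rfl
  rw [hR, integral_integral_swap, ← hsupp]
  · congr 1 with x
    rw [truncInt, integral_smul]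
  · obtain ⟨C, hC⟩ := hgc.exists_bound_of_continuous hg.continuous
    have h1 : Integrable (fun z : Rd d × Rd d ↦ g z.1 • diffQuot σ f z.1 z.2)
        ((volume.restrict K).prod (volume.restrict (annulus d r R))) :=
      (integrable_diffQuot_prod hf hσ hr R hK).bdd_smul (φ := fun z ↦ g z.1) C
        (hg.continuous.comp continuous_fst).aestronglyMeasurable
        (Filter.Eventually.of_forall fun z ↦ hC z.1)
    exact h1.swap

end TruncInt

/-! ### Assembly in the Bessel potential spaces -/

section Assembly

variable {d : ℕ} {p : ℝ≥0∞} [Fact (1 ≤ p)] {X : Type*} [NormedAddCommGroup X] [NormedSpace ℂ X]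
  [CompleteSpace X]

theorem besselJ_besselJ {d : ℕ} {X : Type*} [NormedAddCommGroup X] [NormedSpace ℂ X] (s t : ℝ)
    (u : 𝓢'(Rd d, X)) :
    besselJ d s X (besselJ d t X u) = besselJ d (t + s) X u := by
  unfold besselJ
  rw [TemperedDistribution.fourierMultiplierCLM_fourierMultiplierCLM_apply
    (besselSymbol_hasTemperateGrowth d t) (besselSymbol_hasTemperateGrowth d s), besselSymbol_mul]

theorem HasSymbol.eq_besselJ (hp : p ≠ ∞)
    {B B' : Lp X p (volume : Measure (Rd d)) →L[ℂ] Lp X p (volume : Measure (Rd d))} {m : Rd d → ℂ}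
    {t : ℝ} (h : HasSymbol B m) (h' : HasSymbol B' fun ξ ↦ besselSymbol d t ξ * m ξ)
    (g : Lp X p (volume : Measure (Rd d))) :
    (B' g : 𝓢'(Rd d, X)) = besselJ d t X (B g : 𝓢'(Rd d, X)) :=
  h.eq_fourierMultiplierCLM hp (besselSymbol_hasTemperateGrowth d t) h' g

/-- `H^{s,p}(ℝ^d; X)` is isometric to `L^p(ℝ^d; X)` through `(1 - Δ)^{s/2}`. -/
def BesselSpace.toLpEquiv (d : ℕ) (s : ℝ) (p : ℝ≥0∞) [Fact (1 ≤ p)] (X : Type*)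
    [NormedAddCommGroup X] [NormedSpace ℂ X] [CompleteSpace X] :
    BesselSpace d s p X ≃ₗᵢ[ℂ] Lp X p (volume : Measure (Rd d)) where
  toLinearEquiv := LinearEquiv.ofBijective (toLp d s p X) ⟨toLp_injective d s p X, fun g ↦ by
    have h : besselJ d s X (besselJ d (-s) X g) = g := by
      simpa using besselJ_neg_besselJ d (-s) X (g : 𝓢'(Rd d, X))
    refine ⟨⟨besselJ d (-s) X g, ⟨g, h.symm⟩⟩, ?_⟩
    apply LinearMap.ker_eq_bot.mp
      (Lp.ker_toTemperedDistributionCLM_eq_bot (μ := (volume : Measure (Rd d))) (F := X) (p := p))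
    exact (toLp_spec d s p X _).trans h⟩
  norm_map' _ := rfl

theorem BesselSpace.toLpEquiv_spec {s : ℝ} (u : BesselSpace d s p X) :
    ((toLpEquiv d s p X u : Lp X p (volume : Measure (Rd d))) : 𝓢'(Rd d, X)) =
      besselJ d s X (toDist d s p X u) :=
  toLp_spec d s p X u

theorem BesselSpace.toDist_eq {s : ℝ} (u : BesselSpace d s p X) :
    toDist d s p X u = besselJ d (-s) X
      ((toLpEquiv d s p X u : Lp X p (volume : Measure (Rd d))) : 𝓢'(Rd d, X)) := by
  rw [toLpEquiv_spec, besselJ_neg_besselJ]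

theorem BesselSpace.toDist_toLpEquiv_symm {s : ℝ} (g : Lp X p (volume : Measure (Rd d))) :
    toDist d s p X ((toLpEquiv d s p X).symm g) = besselJ d (-s) X (g : 𝓢'(Rd d, X)) := by
  rw [toDist_eq, LinearIsometryEquiv.apply_symm_apply]

theorem MeasureTheory.Lp.toTemperedDistribution_injective {g g' : Lp X p (volume : Measure (Rd d))}
    (h : (g : 𝓢'(Rd d, X)) = g') : g = g' :=
  Lp.ext_of_lpPairing fun ψ ↦ congrArg (fun u : 𝓢'(Rd d, X) ↦ u ψ) h

theorem BesselSpace.toLpEquiv_ofSchwartz {s : ℝ} (φ : 𝓢(Rd d, X)) :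
    toLpEquiv d s p X (ofSchwartz s p φ) =
      (SchwartzMap.fourierMultiplierCLM X (besselSymbol d s) φ).toLp p := by
  apply Lp.toTemperedDistribution_injective
  rw [toLpEquiv_spec, Lp.toTemperedDistribution_toLp_eq, besselJ]
  exact TemperedDistribution.fourierMultiplierCLM_toTemperedDistributionCLM_eq
    (besselSymbol_hasTemperateGrowth d s) φ

theorem BesselSpace.toLpEquiv_ofTensor_tmul {s : ℝ} (g : BesselSpace d s p ℂ) (x : X) :
    toLpEquiv d s p X (ofTensor d s p X (g ⊗ₜ x)) =
      (ContinuousLinearMap.toSpanSingleton ℂ x).compLp (toLpEquiv d s p ℂ g) := by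
  apply Lp.toTemperedDistribution_injective
  rw [toLpEquiv_spec, toDist_ofTensor_tmul, besselJ_distTensor, ← toLpEquiv_spec]
  ext ψ
  rw [distTensor_apply, ← lpPairing_eq_toTemperedDistribution,
    ← lpPairing_eq_toTemperedDistribution, lpPairing_compLp]

theorem BesselSpace.denseRange_ofSchwartz (hp : p ≠ ∞) (s : ℝ) :
    DenseRange (ofSchwartz (d := d) (X := X) s p) := by
  have h1 := (toLpEquiv d s p X).symm.surjective.denseRange.comp
    (SchwartzMap.denseRange_toLpCLM (E := Rd d) (F := X) (p := p) hp)
    (toLpEquiv d s p X).symm.continuous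
  refine h1.mono ?_
  rintro _ ⟨φ, rfl⟩
  refine ⟨SchwartzMap.fourierMultiplierCLM X (besselSymbol d (-s)) φ, ?_⟩
  apply (toLpEquiv d s p X).injective
  rw [toLpEquiv_ofSchwartz, Function.comp_apply, LinearIsometryEquiv.apply_symm_apply,
    SchwartzMap.toLpCLM_apply, SchwartzMap.fourierMultiplierCLM_fourierMultiplierCLM_apply
      (besselSymbol_hasTemperateGrowth d s) (besselSymbol_hasTemperateGrowth d (-s)),
    besselSymbol_mul, add_neg_cancel, besselSymbol_zero, SchwartzMap.fourierMultiplierCLM_const]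
  simp

/-- The operator `(-Δ)^{σ/2}` from `H^{s,p}(ℝ^d)` to `H^{s-σ,p}(ℝ^d)`, built from the operator `M`
with symbol `|ξ|^σ (1 + |ξ|²)^{-σ/2}`. -/
def fracLaplacianCLM (σ s : ℝ)
    (M : Lp ℂ p (volume : Measure (Rd d)) →L[ℂ] Lp ℂ p (volume : Measure (Rd d))) :
    BesselSpace d s p ℂ →L[ℂ] BesselSpace d (s - σ) p ℂ :=
  ((BesselSpace.toLpEquiv d (s - σ) p ℂ).symm.toContinuousLinearEquiv :
      Lp ℂ p (volume : Measure (Rd d)) →L[ℂ] BesselSpace d (s - σ) p ℂ) ∘L M ∘L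
    ((BesselSpace.toLpEquiv d s p ℂ).toContinuousLinearEquiv :
      BesselSpace d s p ℂ →L[ℂ] Lp ℂ p (volume : Measure (Rd d)))

theorem toDist_fracLaplacianCLM (σ s : ℝ)
    (M : Lp ℂ p (volume : Measure (Rd d)) →L[ℂ] Lp ℂ p (volume : Measure (Rd d)))
    (u : BesselSpace d s p ℂ) :
    BesselSpace.toDist d (s - σ) p ℂ (fracLaplacianCLM σ s M u) =
      besselJ d (σ - s) ℂ (M (BesselSpace.toLpEquiv d s p ℂ u) : 𝓢'(Rd d, ℂ)) := by
  rw [← neg_sub s σ]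
  exact BesselSpace.toDist_toLpEquiv_symm _

theorem isFracLaplacian_fracLaplacianCLM {σ : ℝ} (hσ : 0 ≤ σ) (s : ℝ)
    {M : Lp ℂ p (volume : Measure (Rd d)) →L[ℂ] Lp ℂ p (volume : Measure (Rd d))}
    (hM : HasSymbol M (fracSymbol d σ)) : IsFracLaplacian hσ s p (fracLaplacianCLM σ s M) := by
  intro φ
  rw [toDist_fracLaplacianCLM, BesselSpace.toLpEquiv_ofSchwartz]
  ext ψ
  rw [besselJ, TemperedDistribution.fourierMultiplierCLM_apply_apply,
    ← lpPairing_eq_toTemperedDistribution, hM.lpPairing_eq, fracLaplacianSchwartz,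
    TemperedDistribution.fourierInv_apply, Lp.toTemperedDistribution_apply]
  apply integral_congr_ae
  filter_upwards [(memLp_norm_rpow_smul_schwartz hσ (𝓕 φ)).coeFn_toLp] with ξ hξ
  have h1 : 𝓕⁻ (𝓕 (SchwartzMap.smulLeftCLM ℂ (besselSymbol d (σ - s)) (𝓕⁻ ψ))) =
    SchwartzMap.smulLeftCLM ℂ (besselSymbol d (σ - s)) (𝓕⁻ ψ) :=
    FourierTransform.fourierInv_fourier_eq _
  have h2 : 𝓕 (SchwartzMap.fourierMultiplierCLM ℂ (besselSymbol d s) φ) =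
      SchwartzMap.smulLeftCLM ℂ (besselSymbol d s) (𝓕 φ) := by
    rw [SchwartzMap.fourierMultiplierCLM_apply]
    exact FourierTransform.fourier_fourierInv_eq _
  rw [hξ, h1, h2, SchwartzMap.smulLeftCLM_apply_apply (besselSymbol_hasTemperateGrowth d _),
    SchwartzMap.smulLeftCLM_apply_apply (besselSymbol_hasTemperateGrowth d _), fracSymbol,
    Complex.real_smul]
  have h3 : besselSymbol d (-σ) ξ * besselSymbol d (σ - s) ξ * besselSymbol d s ξ = 1 := by
    rw [← Pi.mul_apply, besselSymbol_mul, ← Pi.mul_apply, besselSymbol_mul,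
      show -σ + (σ - s) + s = 0 by ring, besselSymbol_zero]
  simp only [smul_eq_mul]
  linear_combination ((‖(2 * Real.pi) • ξ‖ ^ σ : ℝ) : ℂ) * (𝓕⁻ ψ ξ) * (𝓕 φ ξ) * h3

/-- On `H^{s,p}(ℝ^d) ⊗ X` an operator `S` with the symbol of `(1 - Δ)^{-1} (-Δ)^{σ/2}` determines
`(-Δ)^{σ/2}`, as it acts on elementary tensors through its scalar version. -/
theorem besselJ_eq_toDist_ofTensor_rTensor (hp : p ≠ ∞) {σ s : ℝ}
    {M S₁ : Lp ℂ p (volume : Measure (Rd d)) →L[ℂ] Lp ℂ p (volume : Measure (Rd d))}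
    {S : Lp X p (volume : Measure (Rd d)) →L[ℂ] Lp X p (volume : Measure (Rd d))}
    (hM : HasSymbol M (fracSymbol d σ))
    (hS₁ : HasSymbol S₁ fun ξ ↦ besselSymbol d (σ - 2) ξ * fracSymbol d σ ξ)
    (hS : HasSymbol S fun ξ ↦ besselSymbol d (σ - 2) ξ * fracSymbol d σ ξ)
    (u : BesselSpace d s p ℂ ⊗[ℂ] X) :
    besselJ d (-(s - 2)) X
        (S (BesselSpace.toLpEquiv d s p X (BesselSpace.ofTensor d s p X u)) : 𝓢'(Rd d, X)) =
      BesselSpace.toDist d (s - σ) p X (BesselSpace.ofTensor d (s - σ) p X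
        ((fracLaplacianCLM σ s M).toLinearMap.rTensor X u)) := by
  induction u with
  | zero => simp [← Lp.toTemperedDistributionCLM_apply]
  | add u v hu hv =>
    simp only [← Lp.toTemperedDistributionCLM_apply, map_add] at hu hv ⊢
    rw [hu, hv]
  | tmul v x =>
    rw [BesselSpace.toLpEquiv_ofTensor_tmul, hS₁.compLp_toSpanSingleton hp hS,
      LinearMap.rTensor_tmul, BesselSpace.toDist_ofTensor_tmul, ContinuousLinearMap.coe_coe,
      toDist_fracLaplacianCLM]
    have h1 : besselJ d (σ - s) ℂ (M (BesselSpace.toLpEquiv d s p ℂ v) : 𝓢'(Rd d, ℂ)) =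
        besselJ d (-(s - 2)) ℂ (S₁ (BesselSpace.toLpEquiv d s p ℂ v) : 𝓢'(Rd d, ℂ)) := by
      rw [hM.eq_besselJ hp hS₁, besselJ_besselJ]
      congr 2
      ring
    rw [h1, ← besselJ_distTensor]
    congr 1
    ext ψ
    rw [distTensor_apply, ← lpPairing_eq_toTemperedDistribution,
      ← lpPairing_eq_toTemperedDistribution, lpPairing_compLp]

end Assembly

end

theorem mainTheorem8 (d : ℕ) (hd : 1 ≤ d) (σ : ℝ) (hσ : 0 < σ) (hσ1 : σ < 1) :
    ∃ c : ℝ, c < 0 ∧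
      (∀ ξ : Rd d,
        Integrable (fun h : Rd d ↦
          (Complex.exp (Complex.I * (inner ℝ h ξ : ℝ)) - 1) / (‖h‖ ^ ((d : ℝ) + σ) : ℝ)) ∧
        ((‖ξ‖ ^ σ : ℝ) : ℂ) = c * ∫ h : Rd d,
          (Complex.exp (Complex.I * (inner ℝ h ξ : ℝ)) - 1) / (‖h‖ ^ ((d : ℝ) + σ) : ℝ)) ∧
      ∀ (p : ℝ≥0∞) [Fact (1 ≤ p)], 1 < p → p < ∞ → ∀ s : ℝ, 0 ≤ s →
        ∃ A : BesselSpace d s p ℂ →L[ℂ] BesselSpace d (s - σ) p ℂ,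
          IsFracLaplacian hσ.le s p A ∧
          (∀ B : BesselSpace d s p ℂ →L[ℂ] BesselSpace d (s - σ) p ℂ,
            IsFracLaplacian hσ.le s p B → B = A) ∧
          ∀ (X : Type*) [NormedAddCommGroup X] [NormedSpace ℂ X] [CompleteSpace X]
            (u : BesselSpace d s p ℂ ⊗[ℂ] X),
            -- `u` is a function in `L^p(ℝ^d; X)`
            (∃ f : Rd d → X,
              IsGivenBy p (BesselSpace.toDist d s p X (BesselSpace.ofTensor d s p X u)) f) ∧
            ∀ f : Rd d → X,
              IsGivenBy p (BesselSpace.toDist d s p X (BesselSpace.ofTensor d s p X u)) f →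
              -- the integrals over the annuli converge absolutely
              (∀ r R : ℝ, 0 < r → r < R → ∀ᵐ x : Rd d,
                IntegrableOn (diffQuot σ f x) (annulus d r R)) ∧
              -- `G r R` and `L` are the truncated integrals and `(-Δ)^{σ/2} u` in `H^{s-2,p}`
              ∃ (G : ℝ → ℝ → BesselSpace d (s - 2) p X) (L : BesselSpace d (s - 2) p X),
                (∀ r R : ℝ, 0 < r → r < R →
                  IsGivenBy p (BesselSpace.toDist d (s - 2) p X (G r R)) (truncInt σ r R f)) ∧
                BesselSpace.toDist d (s - 2) p X L =
                  BesselSpace.toDist d (s - σ) p X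
                    (BesselSpace.ofTensor d (s - σ) p X (A.toLinearMap.rTensor X u)) ∧
                Filter.Tendsto (fun q : ℝ × ℝ ↦ (c : ℂ) • G q.1 q.2)
                  (𝓝[>] (0 : ℝ) ×ˢ Filter.atTop) (𝓝 L) := by
  obtain ⟨c, hc0, hc⟩ := exists_rieszConstant hd hσ hσ1
  refine ⟨c, hc0, fun ξ ↦ ⟨integrable_exp_inner_sub_one_div hd hσ hσ1 ξ, hc ξ⟩,
    fun p _ _ hp s hs ↦ ?_⟩
  have hp' : p ≠ ∞ := hp.ne
  obtain ⟨M, hM⟩ := exists_hasSymbol_fracSymbol (X := ℂ) hd hp' hσ hσ1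
  have hA := isFracLaplacian_fracLaplacianCLM hσ.le s hM
  refine ⟨fracLaplacianCLM σ s M, hA, fun B hB ↦ ?_, fun X _ _ _ u ↦ ?_⟩
  · ext1 v
    revert v
    apply congrFun
    refine (BesselSpace.denseRange_ofSchwartz hp' s).equalizer B.continuous
      (ContinuousLinearMap.continuous _) ?_
    funext φ
    apply BesselSpace.toDist_injective
    exact (hB φ).trans (hA φ).symm
  set g := BesselSpace.toLpEquiv d s p X (BesselSpace.ofTensor d s p X u) with hg_def
  obtain ⟨J, hJ, hJ1⟩ := exists_bessel (X := X) (d := d) hp' hs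
  obtain ⟨S, S', hS, hS', hlim⟩ := exists_smoothed_singular_integral (X := X) hd hp' hσ hσ1 hc
  -- `u` is the function `J g`
  have hJg : BesselSpace.toDist d s p X (BesselSpace.ofTensor d s p X u) = (J g : 𝓢'(Rd d, X)) := by
    rw [BesselSpace.toDist_eq]
    exact (HasSymbol.one.eq_besselJ hp' (by simpa using hJ) g).symm
  refine ⟨⟨J g, Lp.memLp _, by rw [hJg, Lp.toLp_coeFn]⟩, fun f hf ↦ ?_⟩
  obtain ⟨hfp, hfu⟩ := hf
  have hfJ : f =ᵐ[volume] J g := by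
    have h1 : J g = hfp.toLp f := Lp.toTemperedDistribution_injective (hJg.symm.trans hfu)
    rw [h1]
    exact hfp.coeFn_toLp.symm
  have hp1 : 1 ≤ p := Fact.out
  refine ⟨fun r R hr _ ↦ Filter.Eventually.of_forall fun x ↦
    integrableOn_diffQuot_annulus (hfp.locallyIntegrable hp1) hσ.le hr R x,
    fun r R ↦ (BesselSpace.toLpEquiv d (s - 2) p X).symm (S' r R g),
    (BesselSpace.toLpEquiv d (s - 2) p X).symm ((c : ℂ) • S g), fun r R hr _ ↦ ?_, ?_, ?_⟩
  · obtain ⟨hi, T, hT, hTm⟩ := exists_diffIntegral_annulus hp' hσ.le hJ hJ1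
      (norm_besselSymbol_le_one (neg_nonpos.mpr hs)) (R := R) hr
    have h1 : truncInt σ r R f =ᵐ[volume] T g := by
      rw [hT]
      exact truncInt_ae_eq hσ.le hr R hfJ (hi g)
    have h2 : MemLp (truncInt σ r R f) p volume := (Lp.memLp (T g)).ae_eq h1.symm
    refine ⟨h2, ?_⟩
    have h3 : h2.toLp _ = T g := Lp.ext (h2.coeFn_toLp.trans h1)
    rw [h3, BesselSpace.toDist_toLpEquiv_symm]
    refine ((hS' r R).eq_besselJ hp' ?_ g).symm
    convert! hTm using 1
    funext ξ
    rw [← integral_const_mul]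
    congr 1 with h
    have h4 := congrFun (besselSymbol_mul d (-(s - 2)) (-2)) ξ
    rw [show -(s - 2) + -2 = -s by ring, Pi.mul_apply] at h4
    rw [← h4]
    ring
  · rw [BesselSpace.toDist_toLpEquiv_symm]
    obtain ⟨S₁, -, hS₁, -, -⟩ :=
      exists_smoothed_singular_integral (X := ℂ) hd hp' hσ hσ1 hc
    exact besselJ_eq_toDist_ofTensor_rTensor hp' hM hS₁ hS u
  · have h1 := ((BesselSpace.toLpEquiv d (s - 2) p X).symm.continuous.tendsto _).comp
      ((hlim g).const_smul (c : ℂ))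
    exact h1.congr fun q ↦
      (BesselSpace.toLpEquiv d (s - 2) p X).symm.map_smul (c : ℂ) (S' q.1 q.2 g)
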